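/- Let $\mathcal C$ be a monoidal category with unit object $1$ (associativity and unit constraints are suppressed). A \emph{quasi-commutative monoid} in $\mathcal C$ is a monoid $(A,\mu,\iota)$ together with an isomorphism $R:A\otimes A\to A\otimes A$ such that $$(R\otimes I)(I\otimes R)(R\otimes I)=(I\otimes R)(R\otimes I)(I\otimes R),\quad R(\iota\otimes I)=I\otimes\iota,\quad R(I\otimes\iota)=\iota\otimes I,$$ $$R(I\otimes\mu)=(\mu\otimes I)(I\otimes R)(R\otimes I),\quad R(\mu\otimes I)=(I\otimes\mu)(R\otimes I)(I\otimes R),\quad \mu R=\mu .$$ It is \emph{nearly commutative} if moreover $R^2=I$. Homomorphisms are monoid homomorphisms $f$ with $(f\otimes f)R=R(f\otimes f)$. Write $[n]=\{1,\dots,n\}$ for $n\ge 0$. A \emph{symmetric cosimplicial complex of monoids} $A^*$ in $\mathcal C$ is a functor $[n]\mapsto A^n$ from the category of the ordered sets $[n]$, $n\ge 0$, and order preserving maps to the category of monoids in $\mathcal C$, together with a left action of the symmetric group $S_n$ on each $A^n$ by monoid automorphisms, such that $A(\pi)A(f)=A(f')A(\pi')$ whenever $f,f':[m]\to[n]$ are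 order preserving, $\pi\in S_n$, $\pi'\in S_m$, $\pi f=f'\pi'$ as maps of sets, and $\pi'$ preserves the order on each fibre of $f$. If only the $[n]$ with $0\le n\le 3$ are used, the complex is \emph{truncated at length $3$}. Morphisms are natural families of monoid homomorphisms commuting with the symmetric group actions. The complex satisfies the \emph{covering condition} if for every finite (possibly empty) family of order preserving injections $f_i:[n_i]\to[n]$, $i=1,\dots,m$, with pairwise disjoint images whose union is $[n]$, the composite $$A^{n_1}\otimes\cdots\otimes A^{n_m}\xrightarrow{\;\bigotimes_i A(f_i)\;}(A^n)^{\otimes m}\xrightarrow{\;\text{multiplication}\;}A^n$$ is an isomorphism (for $m=0$ this is the unit map $1\to A^0$). Let $\partial_0,\partial_1:A^1\to A^2$ be induced by the maps $[1]\to[2]$ with image $\{2\}$ and $\{1\}$ respectively. \textbf{Theorem.} A structure of a nearly commutative monoid on an object $A$ of $\mathcal C$ is equivalent to each of the following: i) a symmetric cosimplicial complex of monoids $A^*$ in $\mathcal C$ with $A^1=A$, satisfying the covering condition; ii) a symmetric cosimplicial complex of monoids $A^*$ truncated at length $3$ with $A^1=A$, satisfying the covering condition. Precisely: in both cases there is an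 equivalence from the category of these complexes (for all $A$) to the category of nearly commutative monoids in $\mathcal C$, which sends $A^*$ to the monoid $A^1$ with the operator $R$ determined by $\mu(\partial_0\otimes\partial_1)R=\mu(\partial_1\otimes\partial_0)$, and a morphism of complexes to its component on $A^1$. For every object $A$, every nearly commutative structure on $A$ comes from a complex with $A^1=A$, and two complexes with $A^1=A$ which give the same structure on $A$ are isomorphic by a unique isomorphism that is the identity on $A^1$. The equivalence in i) is truncation followed by the equivalence in ii). -/

import Mathlib

open CategoryTheory MonoidalCategory

universe v u

namespace NearlyComm

/-! ### Quasi-commutative and nearly commutative monoids -/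

section Monoids

variable (C : Type u) [Category.{v} C] [MonoidalCategory C]

/-- A quasi-commutative monoid: a monoid with an invertible Yang-Baxter operator `R`,
compatible with the unit and with the multiplication, such that `μ R = μ`. -/
structure QuasiCommMon where
  /-- the underlying monoid -/
  toMon : Mon C
  /-- the Yang-Baxter operator -/
  R : toMon.X ⊗ toMon.X ≅ toMon.X ⊗ toMon.X
  /-- `(R ⊗ I)(I ⊗ R)(R ⊗ I) = (I ⊗ R)(R ⊗ I)(I ⊗ R)` -/
  yang_baxter :
    (R.hom ▷ toMon.X) ≫ (α_ toMon.X toMon.X toMon.X).hom ≫ (toMon.X ◁ R.hom) ≫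
        (α_ toMon.X toMon.X toMon.X).inv ≫ (R.hom ▷ toMon.X) =
      (α_ toMon.X toMon.X toMon.X).hom ≫ (toMon.X ◁ R.hom) ≫
        (α_ toMon.X toMon.X toMon.X).inv ≫ (R.hom ▷ toMon.X) ≫
        (α_ toMon.X toMon.X toMon.X).hom ≫ (toMon.X ◁ R.hom) ≫
        (α_ toMon.X toMon.X toMon.X).inv
  /-- `R (ι ⊗ I) = I ⊗ ι` -/
  one_left : (λ_ toMon.X).inv ≫ (MonObj.one ▷ toMon.X) ≫ R.hom =
    (ρ_ toMon.X).inv ≫ (toMon.X ◁ MonObj.one)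
  /-- `R (I ⊗ ι) = ι ⊗ I` -/
  one_right : (ρ_ toMon.X).inv ≫ (toMon.X ◁ MonObj.one) ≫ R.hom =
    (λ_ toMon.X).inv ≫ (MonObj.one ▷ toMon.X)
  /-- `R (I ⊗ μ) = (μ ⊗ I)(I ⊗ R)(R ⊗ I)` -/
  mul_right : (toMon.X ◁ MonObj.mul) ≫ R.hom =
    (α_ toMon.X toMon.X toMon.X).inv ≫ (R.hom ▷ toMon.X) ≫
      (α_ toMon.X toMon.X toMon.X).hom ≫ (toMon.X ◁ R.hom) ≫
      (α_ toMon.X toMon.X toMon.X).inv ≫ (MonObj.mul ▷ toMon.X)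
  /-- `R (μ ⊗ I) = (I ⊗ μ)(R ⊗ I)(I ⊗ R)` -/
  mul_left : (MonObj.mul ▷ toMon.X) ≫ R.hom =
    (α_ toMon.X toMon.X toMon.X).hom ≫ (toMon.X ◁ R.hom) ≫
      (α_ toMon.X toMon.X toMon.X).inv ≫ (R.hom ▷ toMon.X) ≫
      (α_ toMon.X toMon.X toMon.X).hom ≫ (toMon.X ◁ MonObj.mul)
  /-- `μ R = μ` -/
  quasi_comm : R.hom ≫ MonObj.mul = MonObj.mul

namespace QuasiCommMon

variable {C}

/-- A homomorphism of quasi-commutative monoids: a monoid homomorphism `f` with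
`(f ⊗ f) R = R (f ⊗ f)`. -/
@[ext]
structure Hom (M M' : QuasiCommMon C) where
  /-- the homomorphism of monoids -/
  hom : M.toMon ⟶ M'.toMon
  comm : M.R.hom ≫ (hom.hom ⊗ₘ hom.hom) = (hom.hom ⊗ₘ hom.hom) ≫ M'.R.hom

instance : Category (QuasiCommMon C) where
  Hom := Hom
  id M := ⟨𝟙 _, by simp⟩
  comp f g := ⟨f.hom ≫ g.hom, by
    simp only [Mon.comp_hom', ← MonoidalCategory.tensorHom_comp_tensorHom]
    rw [← Category.assoc, f.comm, Category.assoc, g.comm, Category.assoc]⟩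

/-- `R² = I`. -/
def isNearlyComm : ObjectProperty (QuasiCommMon C) :=
  fun M => M.R.hom ≫ M.R.hom = 𝟙 _

/-- The underlying monoid. -/
def forget : QuasiCommMon C ⥤ Mon C where
  obj M := M.toMon
  map f := f.hom

end QuasiCommMon

/-- The category of nearly commutative monoids (a full subcategory of the quasi-commutative
ones). -/
abbrev NearlyCommMon := (QuasiCommMon.isNearlyComm (C := C)).FullSubcategory

/-- The underlying monoid of a nearly commutative monoid. -/
abbrev NearlyCommMon.forget : NearlyCommMon C ⥤ Mon C :=
  ObjectProperty.ι _ ⋙ QuasiCommMon.forget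

variable {C} in
/-- Structures of a nearly commutative monoid on the object `A`. -/
abbrev NearlyCommOn (A : C) := {M : NearlyCommMon C // M.obj.toMon.X = A}

end Monoids

/-! ### Finite ordinals -/

/-- The finite ordered sets `[n]`, `0 ≤ n ≤ N`; here `[n]` is realised as `Fin n`.
For `N = ⊤` these are all finite ordinals, the empty one included. -/
structure FinOrd (N : ℕ∞) where
  /-- the number of elements -/
  len : ℕ
  len_le : (len : ℕ∞) ≤ N

/-- Morphisms are all order preserving maps. -/
instance (N : ℕ∞) : Category (FinOrd N) where
  Hom k l := Fin k.len →o Fin l.len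
  id _ := OrderHom.id
  comp f g := OrderHom.comp g f

/-- The inclusion of ordinals of length at most `N` into those of length at most `N'`. -/
def FinOrd.incl {N N' : ℕ∞} (h : N ≤ N') : FinOrd N ⥤ FinOrd N' where
  obj k := ⟨k.len, k.len_le.trans h⟩
  map f := f

/-- The ordinal `[1]`. -/
def FinOrd.one {N : ℕ∞} (hN : 3 ≤ N) : FinOrd N := ⟨1, le_trans (by norm_num) hN⟩

/-- The ordinal `[2]`. -/
def FinOrd.two {N : ℕ∞} (hN : 3 ≤ N) : FinOrd N := ⟨2, le_trans (by norm_num) hN⟩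

/-- `∂_j : [1] → [2]`, the order preserving injection whose image omits the element number `j`
(counted from `0`). -/
def FinOrd.d {N : ℕ∞} (hN : 3 ≤ N) (j : Fin 2) : FinOrd.one hN ⟶ FinOrd.two hN :=
  (Fin.succAboveOrderEmb (n := 1) j).toOrderHom

/-! ### Symmetric cosimplicial monoids -/

section Cosimplicial

variable (C : Type u) [Category.{v} C] [MonoidalCategory C]

/-- A symmetric cosimplicial complex of monoids, of length `N` (`N = ⊤`: not truncated): a
functor `A^*` from finite ordinals to monoids, with an action of the symmetric group `S_n` on
`A^n` by monoid automorphisms, compatible with the cosimplicial maps.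

Given `f : [m] → [n]` order preserving and `π ∈ S_n`, there are a unique order preserving
`f' : [m] → [n]` and a unique `π' ∈ S_m`, order preserving on the fibres of `f`, such that
`π f = f' π'` as maps of sets; the compatibility is `A(π) A(f) = A(f') A(π')`. -/
structure SymCosimplicialMon (N : ℕ∞) where
  /-- the cosimplicial complex of monoids -/
  F : FinOrd N ⥤ Mon C
  /-- the symmetric group actions; in `Aut` the product `a * b` is "first `b`, then `a`" -/
  act : ∀ k : FinOrd N, Equiv.Perm (Fin k.len) →* Aut (F.obj k)
  compat : ∀ (k l : FinOrd N) (f f' : Fin k.len →o Fin l.len)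
    (π : Equiv.Perm (Fin l.len)) (π' : Equiv.Perm (Fin k.len)),
    (∀ x, π (f x) = f' (π' x)) → (∀ x y, f x = f y → x ≤ y → π' x ≤ π' y) →
    F.map (X := k) (Y := l) f ≫ (act l π).hom =
      (act k π').hom ≫ F.map (X := k) (Y := l) f'

variable {C}

namespace SymCosimplicialMon

variable {N : ℕ∞}

/-- A map of symmetric cosimplicial monoids: homomorphisms of monoids `X^n → Y^n` commuting
with the cosimplicial maps and with the symmetric group actions. -/
@[ext]
structure Hom (X Y : SymCosimplicialMon C N) where
  /-- the map of cosimplicial monoids -/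
  nat : X.F ⟶ Y.F
  comm : ∀ (k : FinOrd N) (π : Equiv.Perm (Fin k.len)),
    (X.act k π).hom ≫ nat.app k = nat.app k ≫ (Y.act k π).hom

instance : Category (SymCosimplicialMon C N) where
  Hom := Hom
  id X := ⟨𝟙 _, by simp⟩
  comp f g := ⟨f.nat ≫ g.nat, fun k π => by
    rw [NatTrans.comp_app, ← Category.assoc, f.comm, Category.assoc, g.comm, Category.assoc]⟩

end SymCosimplicialMon

/-! ### The covering condition -/

/-- `X_1 ⊗ (X_2 ⊗ (⋯ ⊗ (X_m ⊗ 1)))`. -/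
def tensorFam : (m : ℕ) → (Fin m → C) → C
  | 0, _ => 𝟙_ C
  | m + 1, X => X 0 ⊗ tensorFam m (fun i => X i.succ)

/-- The tensor product of a finite family of morphisms. -/
def tensorFamMap : (m : ℕ) → {X Y : Fin m → C} → (∀ i, X i ⟶ Y i) →
    (tensorFam m X ⟶ tensorFam m Y)
  | 0, _, _, _ => 𝟙 _
  | m + 1, _, _, g => g 0 ⊗ₘ tensorFamMap m (fun i => g i.succ)

/-- The iterated multiplication `B^{⊗ m} → B` of a monoid (the unit map for `m = 0`). -/
def iterMul (B : Mon C) : (m : ℕ) → (tensorFam m (fun _ => B.X) ⟶ B.X)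
  | 0 => MonObj.one
  | m + 1 => (B.X ◁ iterMul B m) ≫ MonObj.mul

/-- The map `M^{n_1} ⊗ ⋯ ⊗ M^{n_m} → (M^n)^{⊗ m} → M^n` given by maps
`f_i : [n_i] → [n]`. -/
def coveringMap {N : ℕ∞} (M : FinOrd N ⥤ Mon C) {m : ℕ} {k : Fin m → FinOrd N} {l : FinOrd N}
    (f : ∀ i, k i ⟶ l) : tensorFam m (fun i => (M.obj (k i)).X) ⟶ (M.obj l).X :=
  tensorFamMap m (Y := fun _ => (M.obj l).X) (fun i => (M.map (f i)).hom) ≫ iterMul (M.obj l) m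

/-- The maps `f_i : [n_i] → [n]` are injective, with pairwise disjoint images covering `[n]`. -/
structure IsCoveringFamily {N : ℕ∞} {m : ℕ} {k : Fin m → FinOrd N} {l : FinOrd N}
    (f : ∀ i, Fin (k i).len →o Fin l.len) : Prop where
  injective : ∀ i, Function.Injective (f i)
  disjoint : ∀ i j, i ≠ j → Disjoint (Set.range (f i)) (Set.range (f j))
  cover : ⋃ i, Set.range (f i) = Set.univ

/-- The covering condition: all covering maps are isomorphisms. -/
def CoveringCondition {N : ℕ∞} (M : FinOrd N ⥤ Mon C) : Prop :=
  ∀ (m : ℕ) (k : Fin m → FinOrd N) (l : FinOrd N) (f : ∀ i, k i ⟶ l),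
    IsCoveringFamily f → IsIso (coveringMap M f)

/-- Symmetric cosimplicial monoids whose cosimplicial monoid satisfies the covering condition. -/
def SymCosimplicialMon.isCovering (N : ℕ∞) : ObjectProperty (SymCosimplicialMon C N) :=
  fun X => CoveringCondition X.F

variable (C) in
/-- The category of length `N` symmetric cosimplicial monoids satisfying the covering
condition. -/
abbrev SymCoveringMon (N : ℕ∞) := (SymCosimplicialMon.isCovering (C := C) N).FullSubcategory

namespace SymCoveringMon

/-- Truncation: forgetting the components `A^n` with `n > N`. -/
def trunc {N N' : ℕ∞} (h : N ≤ N') : SymCoveringMon C N' ⥤ SymCoveringMon C N where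
  obj X :=
    ⟨{ F := FinOrd.incl h ⋙ X.obj.F
       act := fun k => X.obj.act ((FinOrd.incl h).obj k)
       compat := fun k l f f' π π' => X.obj.compat
         ((FinOrd.incl h).obj k) ((FinOrd.incl h).obj l) f f' π π' },
     fun m k l f hf => X.property m (fun i => (FinOrd.incl h).obj (k i))
       ((FinOrd.incl h).obj l) f ⟨hf.injective, hf.disjoint, hf.cover⟩⟩
  map φ := ObjectProperty.homMk
    ⟨Functor.whiskerLeft (FinOrd.incl h) φ.hom.nat, fun k π => φ.hom.comm ((FinOrd.incl h).obj k) π⟩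

/-- The functor `A^* ↦ A^1`. -/
def ev {N : ℕ∞} (hN : 3 ≤ N) : SymCoveringMon C N ⥤ Mon C where
  obj X := X.obj.F.obj (FinOrd.one hN)
  map φ := φ.hom.nat.app (FinOrd.one hN)

/-- The map `μ (∂_i ⊗ ∂_j) : A^1 ⊗ A^1 → A^2 ⊗ A^2 → A^2`. -/
def dd {N : ℕ∞} (hN : 3 ≤ N) (X : SymCoveringMon C N) (i j : Fin 2) :
    ((ev hN).obj X).X ⊗ ((ev hN).obj X).X ⟶ (X.obj.F.obj (FinOrd.two hN)).X :=
  ((X.obj.F.map (FinOrd.d hN i)).hom ⊗ₘ (X.obj.F.map (FinOrd.d hN j)).hom) ≫ MonObj.mul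

/-- Complexes `A^*` with `A^1 = A`. -/
abbrev On {N : ℕ∞} (hN : 3 ≤ N) (A : C) := {X : SymCoveringMon C N // ((ev hN).obj X).X = A}

end SymCoveringMon

/-- An equivalence of categories between the length `N` symmetric cosimplicial monoids satisfying
the covering condition and the nearly commutative monoids is *compatible with the first component*
if it sends `A^*` to the monoid `A^1` with the Yang-Baxter operator given by
`μ (∂_0 ⊗ ∂_1) R = μ (∂_1 ⊗ ∂_0)`, and if for every object `A` it identifies the structures of
a nearly commutative monoid on `A` with the complexes with `A^1 = A`, up to isomorphisms that
are the identity on `A^1`. -/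
structure IsCompatible {N : ℕ∞} (hN : 3 ≤ N) (E : SymCoveringMon C N ≌ NearlyCommMon C) :
    Prop where
  /-- the underlying monoid is `A^1` (on objects and on morphisms) -/
  forget_eq : E.functor ⋙ NearlyCommMon.forget C = SymCoveringMon.ev hN
  /-- `μ (∂_0 ⊗ ∂_1) R = μ (∂_1 ⊗ ∂_0)`, where `e` is the identification from `forget_eq` -/
  yang_baxter : ∀ X : SymCoveringMon C N,
    let e : (E.functor.obj X).obj.toMon.X ⟶ ((SymCoveringMon.ev hN).obj X).X :=
      (eqToHom (Functor.congr_obj forget_eq X)).hom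
    (E.functor.obj X).obj.R.hom ≫ (e ⊗ₘ e) ≫ SymCoveringMon.dd hN X 0 1 =
      (e ⊗ₘ e) ≫ SymCoveringMon.dd hN X 1 0
  /-- every structure on `A` comes from a complex with `A^1 = A` -/
  exists_complex : ∀ (A : C) (S : NearlyCommOn A),
    ∃ X : SymCoveringMon.On hN A, E.functor.obj X.1 = S.1
  /-- two complexes with `A^1 = A` giving the same structure on `A` are isomorphic by a unique
  isomorphism that is the identity on `A` -/
  unique_complex : ∀ (A : C) (S : NearlyCommOn A) (X Y : SymCoveringMon.On hN A),
    E.functor.obj X.1 = S.1 → E.functor.obj Y.1 = S.1 →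
    ∃! φ : X.1 ≅ Y.1, ((SymCoveringMon.ev hN).map φ.hom).hom = eqToHom (X.2.trans Y.2.symm)

end Cosimplicial

end NearlyComm

/-! The complex attached to a nearly commutative monoid `A` has the twisted tensor power `A^{⊗n}` in
degree `n`, and this power has a universal property: homomorphisms from it to a monoid `B`
correspond to families of `n` homomorphisms `A → B` that commute pairwise up to `R`, in the sense of
`RComm`. Here `μR = μ` makes a homomorphism commute with itself, and `R² = I` makes the relation
symmetric. Hence every map of sets `[m] → [n]`, monotone or not, induces a homomorphism, and all
identities of the complex follow by functoriality.

Existence of the powers rests on half-braidings `X ⊗ A → A ⊗ X`: a monoid `P` with a compatible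
half-braiding yields a monoid `A ⊗ P` of the same kind, the Yang-Baxter equation keeping the
iteration going (`compat_braid`, `BraidedMon.twist`).

Conversely, in a complex with the covering condition the points `[1] → [n]` give homomorphisms `A^1
→ A^n` whose product is invertible. Degree 2 defines `R` and gives its laws for unit and
multiplication, the map `[2] → [1]` gives `μR = μ`, the action of `S_2` gives `R² = I`, and degree 3
gives Yang-Baxter; so length 3 suffices. By `isCover_pt` every `A^n` then has the universal property
of the twisted power, so morphisms of complexes are the same as homomorphisms on `A^1`. -/

namespace NearlyComm

/-! ### Half-braidings and the twisted multiplication on `A ⊗ P`. -/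

section HalfBraid

open MonObj

variable {C : Type u} [Category.{v} C] [MonoidalCategory C] {A : C} [MonObj A]

/-- A half-braiding of an object `X` with a monoid `A` carrying an operator `R`. -/
structure HalfBraid (R : A ⊗ A ⟶ A ⊗ A) (X : C) where
  /-- the operator moving `A` to the left of `X` -/
  β : X ⊗ A ⟶ A ⊗ X
  one : X ◁ η[A] ≫ β = (ρ_ X).hom ≫ (λ_ X).inv ≫ η[A] ▷ X
  mul : X ◁ μ[A] ≫ β =
    (α_ X A A).inv ≫ β ▷ A ≫ (α_ A X A).hom ≫ A ◁ β ≫ (α_ A A X).inv ≫ μ[A] ▷ X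
  yang_baxter : (α_ X A A).hom ≫ X ◁ R ≫ (α_ X A A).inv ≫ β ▷ A ≫ (α_ A X A).hom ≫ A ◁ β =
    β ▷ A ≫ (α_ A X A).hom ≫ A ◁ β ≫ (α_ A A X).inv ≫ R ▷ X ≫ (α_ A A X).hom

namespace HalfBraid

variable {R : A ⊗ A ⟶ A ⊗ A} {X Y Z : C}

/-- A morphism compatible with half-braidings. -/
def Compat (b : HalfBraid R X) (c : HalfBraid R Y) (f : X ⟶ Y) : Prop :=
  f ▷ A ≫ c.β = b.β ≫ A ◁ f

/-- The half-braiding of the unit object. -/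
def unit (R : A ⊗ A ⟶ A ⊗ A) : HalfBraid R (𝟙_ C) where
  β := (λ_ A).hom ≫ (ρ_ A).inv
  one := by simp [unitors_equal, unitors_inv_equal]
  mul := by simp
  yang_baxter := by simp

/-- The half-braiding of a tensor product. -/
def tensor (b : HalfBraid R X) (c : HalfBraid R Y) : HalfBraid R (X ⊗ Y) where
  β := (α_ X Y A).hom ≫ X ◁ c.β ≫ (α_ X A Y).inv ≫ b.β ▷ Y ≫ (α_ A X Y).hom
  one := by
    calc
      _ = 𝟙 _ ⊗≫ X ◁ (Y ◁ η[A] ≫ c.β) ⊗≫ b.β ▷ Y ⊗≫ 𝟙 _ := by monoidal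
      _ = 𝟙 _ ⊗≫ (X ◁ η[A] ≫ b.β) ▷ Y ⊗≫ 𝟙 _ := by rw [c.one]; monoidal
      _ = _ := by rw [b.one]; monoidal
  mul := by
    calc
      _ = 𝟙 _ ⊗≫ X ◁ (Y ◁ μ[A] ≫ c.β) ⊗≫ b.β ▷ Y ⊗≫ 𝟙 _ := by monoidal
      _ = 𝟙 _ ⊗≫ X ◁ c.β ▷ A ⊗≫ X ◁ A ◁ c.β ⊗≫ (X ◁ μ[A] ≫ b.β) ▷ Y ⊗≫ 𝟙 _ := by
        rw [c.mul]; monoidal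
      _ = 𝟙 _ ⊗≫ X ◁ c.β ▷ A ⊗≫ ((X ⊗ A) ◁ c.β ≫ b.β ▷ (A ⊗ Y)) ⊗≫
            A ◁ b.β ▷ Y ⊗≫ μ[A] ▷ X ▷ Y ⊗≫ 𝟙 _ := by rw [b.mul]; monoidal
      _ = _ := by rw [whisker_exchange]; monoidal
  yang_baxter := by
    calc
      _ = 𝟙 _ ⊗≫ X ◁ Y ◁ R ⊗≫ X ◁ c.β ▷ A ⊗≫ (b.β ▷ (Y ⊗ A) ≫ (A ⊗ X) ◁ c.β) ⊗≫
            A ◁ b.β ▷ Y ⊗≫ 𝟙 _ := by monoidal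
      _ = 𝟙 _ ⊗≫ X ◁ ((α_ Y A A).hom ≫ Y ◁ R ≫ (α_ Y A A).inv ≫ c.β ▷ A ≫ (α_ A Y A).hom ≫
            A ◁ c.β) ⊗≫ b.β ▷ A ▷ Y ⊗≫ A ◁ b.β ▷ Y ⊗≫ 𝟙 _ := by
        rw [← whisker_exchange]; monoidal
      _ = 𝟙 _ ⊗≫ X ◁ c.β ▷ A ⊗≫ X ◁ A ◁ c.β ⊗≫
            ((α_ X A A).hom ≫ X ◁ R ≫ (α_ X A A).inv ≫ b.β ▷ A ≫ (α_ A X A).hom ≫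
              A ◁ b.β) ▷ Y ⊗≫ 𝟙 _ := by
        rw [c.yang_baxter]; monoidal
      _ = 𝟙 _ ⊗≫ X ◁ c.β ▷ A ⊗≫ ((X ⊗ A) ◁ c.β ≫ b.β ▷ (A ⊗ Y)) ⊗≫
            A ◁ b.β ▷ Y ⊗≫ R ▷ X ▷ Y ⊗≫ 𝟙 _ := by
        rw [b.yang_baxter]; monoidal
      _ = _ := by rw [whisker_exchange]; monoidal

namespace Compat

variable {b : HalfBraid R X} {c : HalfBraid R Y} {d : HalfBraid R Z}

theorem comp {f : X ⟶ Y} {g : Y ⟶ Z} (hf : Compat b c f) (hg : Compat c d g) :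
    Compat b d (f ≫ g) := by
  unfold Compat at *
  rw [comp_whiskerRight, Category.assoc, hg, reassoc_of% hf, MonoidalCategory.whiskerLeft_comp]

theorem inv {f : X ≅ Y} (hf : Compat b c f.hom) : Compat c b f.inv := by
  unfold Compat at *
  rw [← cancel_epi (f.hom ▷ A), reassoc_of% hf]
  simp [← MonoidalCategory.whiskerLeft_comp, ← comp_whiskerRight_assoc]

theorem whiskerLeft {g : Y ⟶ Z} (b : HalfBraid R X) (hg : Compat c d g) :
    Compat (b.tensor c) (b.tensor d) (X ◁ g) := by
  unfold Compat at *
  simp only [tensor]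
  calc
    _ = 𝟙 _ ⊗≫ X ◁ (g ▷ A ≫ d.β) ⊗≫ b.β ▷ Z ⊗≫ 𝟙 _ := by monoidal
    _ = 𝟙 _ ⊗≫ X ◁ c.β ⊗≫ ((X ⊗ A) ◁ g ≫ b.β ▷ Z) ⊗≫ 𝟙 _ := by rw [hg]; monoidal
    _ = _ := by rw [whisker_exchange]; monoidal

theorem whiskerRight {g : Y ⟶ Z} (hg : Compat c d g) (b : HalfBraid R X) :
    Compat (c.tensor b) (d.tensor b) (g ▷ X) := by
  unfold Compat at *
  simp only [tensor]
  calc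
    _ = 𝟙 _ ⊗≫ (g ▷ (X ⊗ A) ≫ Z ◁ b.β) ⊗≫ d.β ▷ X ⊗≫ 𝟙 _ := by monoidal
    _ = 𝟙 _ ⊗≫ Y ◁ b.β ⊗≫ (g ▷ A ≫ d.β) ▷ X ⊗≫ 𝟙 _ := by rw [← whisker_exchange]; monoidal
    _ = _ := by rw [hg]; monoidal

theorem associator (b : HalfBraid R X) (c : HalfBraid R Y) (d : HalfBraid R Z) :
    Compat ((b.tensor c).tensor d) (b.tensor (c.tensor d)) (α_ X Y Z).hom := by
  simp only [Compat, tensor]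
  monoidal

theorem leftUnitor (b : HalfBraid R X) : Compat ((unit R).tensor b) b (λ_ X).hom := by
  simp only [Compat, tensor, unit]
  monoidal

theorem rightUnitor (b : HalfBraid R X) : Compat (b.tensor (unit R)) b (ρ_ X).hom := by
  simp only [Compat, tensor, unit]
  monoidal

end Compat

end HalfBraid

/-- The multiplication on `A ⊗ P` given by a distributive law `P ⊗ A ⟶ A ⊗ P`. -/
def twistMul {P : C} [MonObj P] (l : P ⊗ A ⟶ A ⊗ P) : (A ⊗ P) ⊗ (A ⊗ P) ⟶ A ⊗ P :=
  (α_ A P (A ⊗ P)).hom ≫ A ◁ (α_ P A P).inv ≫ A ◁ (l ▷ P) ≫ A ◁ (α_ A P P).hom ≫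
    (α_ A A (P ⊗ P)).inv ≫ μ[A] ▷ (P ⊗ P) ≫ A ◁ μ[P]

/-- The unit of `A ⊗ P`. -/
def twistOne (A P : C) [MonObj A] [MonObj P] : 𝟙_ C ⟶ A ⊗ P :=
  (λ_ (𝟙_ C)).inv ≫ η[A] ▷ 𝟙_ C ≫ A ◁ η[P]

variable {R : A ⊗ A ⟶ A ⊗ A} {P : C} [MonObj P]

/-- `β` is a distributive law between the monoids `A` and `P`: `b.one` and `b.mul` are its two laws
for `A`, compatibility of `η[P]` and `μ[P]` its two laws for `P`. The unit and associativity laws of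
`A ⊗ P` use exactly these. -/
theorem twist_one_mul (b : HalfBraid R P)
    (h1 : HalfBraid.Compat (HalfBraid.unit R) b η[P]) :
    twistOne A P ▷ (A ⊗ P) ≫ twistMul b.β = (λ_ (A ⊗ P)).hom := by
  simp only [HalfBraid.Compat, HalfBraid.unit, Category.assoc] at h1
  simp only [twistMul, twistOne]
  calc
    _ = 𝟙 _ ⊗≫ η[A] ▷ A ▷ P ⊗≫ A ◁ (η[P] ▷ A ≫ b.β) ▷ P ⊗≫ μ[A] ▷ (P ⊗ P) ≫ A ◁ μ[P] := by
      monoidal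
    _ = 𝟙 _ ⊗≫ η[A] ▷ A ▷ P ⊗≫ ((A ⊗ A) ◁ (η[P] ▷ P) ≫ μ[A] ▷ (P ⊗ P)) ≫ A ◁ μ[P] := by
      rw [h1]; monoidal
    _ = 𝟙 _ ⊗≫ (η[A] ▷ A ≫ μ[A]) ▷ P ⊗≫ A ◁ (η[P] ▷ P ≫ μ[P]) := by
      rw [whisker_exchange]; monoidal
    _ = _ := by rw [MonObj.one_mul, MonObj.one_mul]; monoidal

theorem twist_mul_one (b : HalfBraid R P) :
    (A ⊗ P) ◁ twistOne A P ≫ twistMul b.β = (ρ_ (A ⊗ P)).hom := by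
  simp only [twistMul, twistOne]
  calc
    _ = 𝟙 _ ⊗≫ A ◁ P ◁ η[A] ⊗≫ A ◁ ((P ⊗ A) ◁ η[P] ≫ b.β ▷ P) ⊗≫
          μ[A] ▷ (P ⊗ P) ≫ A ◁ μ[P] := by
      monoidal
    _ = 𝟙 _ ⊗≫ A ◁ (P ◁ η[A] ≫ b.β) ⊗≫ ((A ⊗ A) ◁ P ◁ η[P] ≫ μ[A] ▷ (P ⊗ P)) ≫ A ◁ μ[P] := by
      rw [whisker_exchange]; monoidal
    _ = 𝟙 _ ⊗≫ (A ◁ η[A] ≫ μ[A]) ▷ P ⊗≫ A ◁ (P ◁ η[P] ≫ μ[P]) := by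
      rw [whisker_exchange, b.one]; monoidal
    _ = _ := by rw [MonObj.mul_one, MonObj.mul_one]; monoidal

theorem twist_mul_assoc (b : HalfBraid R P)
    (h2 : HalfBraid.Compat (b.tensor b) b μ[P]) :
    twistMul b.β ▷ (A ⊗ P) ≫ twistMul b.β =
      (α_ (A ⊗ P) (A ⊗ P) (A ⊗ P)).hom ≫ (A ⊗ P) ◁ twistMul b.β ≫ twistMul b.β := by
  simp only [HalfBraid.Compat, HalfBraid.tensor, Category.assoc] at h2
  simp only [twistMul]
  calc
    _ = 𝟙 _ ⊗≫ A ◁ b.β ▷ P ▷ A ▷ P ⊗≫ μ[A] ▷ P ▷ P ▷ A ▷ P ⊗≫ A ◁ (μ[P] ▷ A ≫ b.β) ▷ P ⊗≫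
          μ[A] ▷ (P ⊗ P) ≫ A ◁ μ[P] := by monoidal
    _ = 𝟙 _ ⊗≫ A ◁ b.β ▷ P ▷ A ▷ P ⊗≫ (μ[A] ▷ (P ⊗ (P ⊗ A) ⊗ P) ≫ A ◁ P ◁ b.β ▷ P) ⊗≫
          A ◁ b.β ▷ P ▷ P ⊗≫ ((A ⊗ A) ◁ (μ[P] ▷ P) ≫ μ[A] ▷ (P ⊗ P)) ≫ A ◁ μ[P] := by
      rw [h2]; monoidal
    _ = 𝟙 _ ⊗≫ A ◁ b.β ▷ P ▷ A ▷ P ⊗≫ A ◁ A ◁ P ◁ b.β ▷ P ⊗≫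
          (μ[A] ▷ ((P ⊗ A) ⊗ P ⊗ P) ≫ A ◁ b.β ▷ (P ⊗ P)) ⊗≫
            μ[A] ▷ P ▷ P ▷ P ⊗≫ A ◁ (μ[P] ▷ P ≫ μ[P]) := by
      rw [whisker_exchange, ← whisker_exchange]; monoidal
    _ = 𝟙 _ ⊗≫ A ◁ b.β ▷ P ▷ A ▷ P ⊗≫ A ◁ A ◁ P ◁ b.β ▷ P ⊗≫ A ◁ A ◁ b.β ▷ P ▷ P ⊗≫
          (μ[A] ▷ A ≫ μ[A]) ▷ P ▷ P ▷ P ⊗≫ A ◁ (μ[P] ▷ P ≫ μ[P]) := by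
      rw [← whisker_exchange]; monoidal
    _ = 𝟙 _ ⊗≫ A ◁ (b.β ▷ (P ⊗ A) ≫ (A ⊗ P) ◁ b.β) ▷ P ⊗≫ A ◁ A ◁ b.β ▷ P ▷ P ⊗≫
          A ◁ μ[A] ▷ P ▷ P ▷ P ⊗≫ ((μ[A] ▷ (P ⊗ (P ⊗ P))) ≫ A ◁ P ◁ μ[P]) ≫ A ◁ μ[P] := by
      rw [MonObj.mul_assoc, MonObj.mul_assoc]; monoidal
    _ = 𝟙 _ ⊗≫ A ◁ (P ⊗ A) ◁ b.β ▷ P ⊗≫ A ◁ ((α_ P A A).inv ≫ b.β ▷ A ≫ (α_ A P A).hom ≫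
            A ◁ b.β ≫ (α_ A A P).inv ≫ μ[A] ▷ P) ▷ (P ⊗ P) ⊗≫
          A ◁ A ◁ P ◁ μ[P] ⊗≫ μ[A] ▷ (P ⊗ P) ≫ A ◁ μ[P] := by
      rw [← whisker_exchange, ← whisker_exchange]; monoidal
    _ = 𝟙 _ ⊗≫ A ◁ (P ⊗ A) ◁ b.β ▷ P ⊗≫ A ◁ P ◁ μ[A] ▷ P ▷ P ⊗≫
          A ◁ (b.β ▷ (P ⊗ P) ≫ (A ⊗ P) ◁ μ[P]) ⊗≫ μ[A] ▷ (P ⊗ P) ≫ A ◁ μ[P] := by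
      rw [← b.mul]; monoidal
    _ = _ := by rw [← whisker_exchange]; monoidal

end HalfBraid

/-! ### Products of generalized elements of a monoid. -/

section Convolution

open MonObj

variable {C : Type u} [Category.{v} C] [MonoidalCategory C] {B B' X Y Z X' Y' : C}
  [MonObj B] [MonObj B']

/-- The product of two generalized elements of a monoid. -/
def conv (x : X ⟶ B) (y : Y ⟶ B) : X ⊗ Y ⟶ B := (x ⊗ₘ y) ≫ μ[B]

local infixr:81 " ⋆ " => conv

theorem whiskerLeft_conv (x : X ⟶ B) (v : Y' ⟶ Y) (y : Y ⟶ B) :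
    X ◁ v ≫ x ⋆ y = x ⋆ (v ≫ y) := by
  simp [conv, tensorHom_def']

theorem whiskerRight_conv (u : X' ⟶ X) (x : X ⟶ B) (y : Y ⟶ B) :
    u ▷ Y ≫ x ⋆ y = (u ≫ x) ⋆ y := by
  simp [conv, MonoidalCategory.tensorHom_def]

theorem tensorHom_conv (u : X' ⟶ X) (v : Y' ⟶ Y) (x : X ⟶ B) (y : Y ⟶ B) :
    (u ⊗ₘ v) ≫ x ⋆ y = (u ≫ x) ⋆ (v ≫ y) := by
  simp [conv]

theorem conv_assoc (x : X ⟶ B) (y : Y ⟶ B) (z : Z ⟶ B) :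
    (x ⋆ y) ⋆ z = (α_ X Y Z).hom ≫ x ⋆ y ⋆ z := by
  simp only [conv, MonoidalCategory.tensorHom_def, comp_whiskerRight, Category.assoc,
    MonoidalCategory.whiskerLeft_comp]
  rw [← whisker_exchange_assoc, MonObj.mul_assoc]
  simp

theorem conv_assoc' (x : X ⟶ B) (y : Y ⟶ B) (z : Z ⟶ B) :
    x ⋆ y ⋆ z = (α_ X Y Z).inv ≫ (x ⋆ y) ⋆ z := by
  simp [conv_assoc]

@[simp]
theorem one_conv (y : Y ⟶ B) : η[B] ⋆ y = (λ_ Y).hom ≫ y := by simp [conv]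

@[simp]
theorem conv_one (y : Y ⟶ B) : y ⋆ η[B] = (ρ_ Y).hom ≫ y := by simp [conv]

theorem conv_comp (x : X ⟶ B) (y : Y ⟶ B) (g : B ⟶ B') [IsMonHom g] :
    x ⋆ y ≫ g = (x ≫ g) ⋆ (y ≫ g) := by
  simp [conv]

theorem mul_comp_eq_conv (g : B ⟶ B') [IsMonHom g] : μ[B] ≫ g = g ⋆ g := by simp [conv]

/-- The product of a finite family of generalized elements of a monoid. -/
def famProd (B : Mon C) (m : ℕ) {X : Fin m → C} (x : ∀ i, X i ⟶ B.X) : tensorFam m X ⟶ B.X :=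
  tensorFamMap m (Y := fun _ => B.X) x ≫ iterMul B m

theorem famProd_zero (B : Mon C) {X : Fin 0 → C} (x : ∀ i, X i ⟶ B.X) :
    famProd B 0 x = η[B.X] :=
  Category.id_comp _

theorem famProd_succ (B : Mon C) (m : ℕ) {X : Fin (m + 1) → C} (x : ∀ i, X i ⟶ B.X) :
    famProd B (m + 1) x = x 0 ⋆ famProd B m (fun i => x i.succ) := by
  change (x 0 ⊗ₘ tensorFamMap m (Y := fun _ => B.X) (fun i => x i.succ)) ≫
    (B.X ◁ iterMul B m) ≫ μ = _
  simp [conv, famProd, MonoidalCategory.tensorHom_def]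

theorem famProd_comp {B B' : Mon C} (m : ℕ) {X : Fin m → C} (x : ∀ i, X i ⟶ B.X) (g : B ⟶ B') :
    famProd B m x ≫ g.hom = famProd B' m (fun i => x i ≫ g.hom) := by
  induction m with
  | zero =>
    rw [famProd_zero, famProd_zero]
    exact IsMonHom.one_hom _
  | succ m ih =>
    rw [famProd_succ, famProd_succ]
    exact (conv_comp _ _ _).trans (by rw [ih])

end Convolution

/-! ### The tower of twisted tensor powers. -/

section Tower

open MonObj

variable {C : Type u} [Category.{v} C] [MonoidalCategory C]

local infixr:81 " ⋆ " => conv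

section Twist

variable {A : C} [MonObj A] {R : A ⊗ A ⟶ A ⊗ A} {P : C} [MonObj P]

/-- The first inclusion of a twisted tensor product. -/
def twistInl (A P : C) [MonObj P] : A ⟶ A ⊗ P := (ρ_ A).inv ≫ A ◁ η[P]

/-- The second inclusion of a twisted tensor product. -/
def twistInr (A P : C) [MonObj A] : P ⟶ A ⊗ P := (λ_ P).inv ≫ η[A] ▷ P

theorem one_twistInl : η[A] ≫ twistInl A P = twistOne A P := by
  simp only [twistInl, twistOne]; monoidal

theorem one_twistInr : η[P] ≫ twistInr A P = twistOne A P := by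
  simp only [twistInr, twistOne]
  calc
    _ = 𝟙 _ ⊗≫ (𝟙_ C ◁ η[P] ≫ η[A] ▷ P) := by monoidal
    _ = _ := by rw [whisker_exchange]; monoidal

theorem twistInl_mul (b : HalfBraid R P) (h1 : HalfBraid.Compat (HalfBraid.unit R) b η[P]) :
    μ[A] ≫ twistInl A P = (twistInl A P ⊗ₘ twistInl A P) ≫ twistMul b.β := by
  simp only [HalfBraid.Compat, HalfBraid.unit, Category.assoc] at h1
  simp only [twistInl, twistMul, MonoidalCategory.tensorHom_def]
  symm
  calc
    _ = 𝟙 _ ⊗≫ (A ◁ η[P]) ▷ A ⊗≫ A ◁ ((P ⊗ A) ◁ η[P] ≫ b.β ▷ P) ⊗≫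
          μ[A] ▷ (P ⊗ P) ≫ A ◁ μ[P] := by monoidal
    _ = 𝟙 _ ⊗≫ A ◁ (η[P] ▷ A ≫ b.β) ⊗≫ ((A ⊗ A) ◁ P ◁ η[P] ≫ μ[A] ▷ (P ⊗ P)) ≫ A ◁ μ[P] := by
      rw [whisker_exchange]; monoidal
    _ = 𝟙 _ ⊗≫ ((A ⊗ A) ◁ η[P] ≫ μ[A] ▷ P) ⊗≫ A ◁ (P ◁ η[P] ≫ μ[P]) := by
      rw [h1, whisker_exchange]; monoidal
    _ = _ := by rw [MonObj.mul_one, whisker_exchange]; monoidal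

theorem twistInr_mul (b : HalfBraid R P) :
    μ[P] ≫ twistInr A P = (twistInr A P ⊗ₘ twistInr A P) ≫ twistMul b.β := by
  simp only [twistInr, twistMul, MonoidalCategory.tensorHom_def]
  symm
  calc
    _ = 𝟙 _ ⊗≫ η[A] ▷ P ▷ P ⊗≫ A ◁ (P ◁ η[A] ≫ b.β) ▷ P ⊗≫ μ[A] ▷ (P ⊗ P) ≫ A ◁ μ[P] := by
      monoidal
    _ = 𝟙 _ ⊗≫ η[A] ▷ P ▷ P ⊗≫ (A ◁ η[A] ≫ μ[A]) ▷ (P ⊗ P) ≫ A ◁ μ[P] := by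
      rw [b.one]; monoidal
    _ = 𝟙 _ ⊗≫ η[A] ▷ (P ⊗ P) ≫ A ◁ μ[P] := by rw [MonObj.mul_one]; monoidal
    _ = _ := by rw [← whisker_exchange]; monoidal

theorem twistInl_twistInr (b : HalfBraid R P) (h1 : HalfBraid.Compat (HalfBraid.unit R) b η[P]) :
    (twistInl A P ⊗ₘ twistInr A P) ≫ twistMul b.β = 𝟙 _ := by
  simp only [HalfBraid.Compat, HalfBraid.unit, Category.assoc] at h1
  simp only [twistInr, twistInl, twistMul, MonoidalCategory.tensorHom_def]
  calc
    _ = 𝟙 _ ⊗≫ A ◁ (η[P] ▷ (𝟙_ C ⊗ P) ≫ P ◁ η[A] ▷ P) ⊗≫ A ◁ b.β ▷ P ⊗≫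
          μ[A] ▷ (P ⊗ P) ≫ A ◁ μ[P] := by monoidal
    _ = 𝟙 _ ⊗≫ A ◁ η[A] ▷ P ⊗≫ A ◁ (η[P] ▷ A ≫ b.β) ▷ P ⊗≫
          μ[A] ▷ (P ⊗ P) ≫ A ◁ μ[P] := by rw [← whisker_exchange]; monoidal
    _ = 𝟙 _ ⊗≫ A ◁ η[A] ▷ P ⊗≫ ((A ⊗ A) ◁ (η[P] ▷ P) ≫ μ[A] ▷ (P ⊗ P)) ≫ A ◁ μ[P] := by
      rw [h1]; monoidal
    _ = 𝟙 _ ⊗≫ (A ◁ η[A] ≫ μ[A]) ▷ P ⊗≫ A ◁ (η[P] ▷ P ≫ μ[P]) := by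
      rw [whisker_exchange]; monoidal
    _ = _ := by rw [MonObj.mul_one, MonObj.one_mul]; monoidal

/-- In the order `A`, `P` the two inclusions multiply to the identity; in the opposite order the
twist appears. Together these determine how the factors commute. -/
theorem twistInr_twistInl (b : HalfBraid R P) :
    (twistInr A P ⊗ₘ twistInl A P) ≫ twistMul b.β = b.β := by
  simp only [twistInr, twistInl, twistMul, MonoidalCategory.tensorHom_def]
  calc
    _ = 𝟙 _ ⊗≫ η[A] ▷ P ▷ A ⊗≫ A ◁ ((P ⊗ A) ◁ η[P] ≫ b.β ▷ P) ⊗≫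
          μ[A] ▷ (P ⊗ P) ≫ A ◁ μ[P] := by monoidal
    _ = 𝟙 _ ⊗≫ (η[A] ▷ (P ⊗ A) ≫ A ◁ b.β) ⊗≫ ((A ⊗ A) ◁ P ◁ η[P] ≫ μ[A] ▷ (P ⊗ P)) ≫
          A ◁ μ[P] := by
      rw [whisker_exchange]; monoidal
    _ = 𝟙 _ ⊗≫ b.β ⊗≫ η[A] ▷ A ▷ P ⊗≫ ((A ⊗ A) ◁ P ◁ η[P] ≫ μ[A] ▷ (P ⊗ P)) ≫ A ◁ μ[P] := by
      rw [← whisker_exchange]; monoidal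
    _ = 𝟙 _ ⊗≫ b.β ⊗≫ (η[A] ▷ A ≫ μ[A]) ▷ P ⊗≫ A ◁ (P ◁ η[P] ≫ μ[P]) := by
      rw [whisker_exchange]; monoidal
    _ = _ := by rw [MonObj.mul_one, MonObj.one_mul]; monoidal

/-- The two products of inclusions are `β` and the identity, so the claim reduces to compatibility
of `p` with the half-braidings. -/
theorem twist_rComm (b : HalfBraid R P) (h1 : HalfBraid.Compat (HalfBraid.unit R) b η[P])
    (r : HalfBraid R A) (hr : r.β = R) (p : A ⟶ P) (hp : HalfBraid.Compat r b p) :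
    ((p ≫ twistInr A P) ⊗ₘ twistInl A P) ≫ twistMul b.β =
      R ≫ (twistInl A P ⊗ₘ (p ≫ twistInr A P)) ≫ twistMul b.β := by
  have e1 : ((p ≫ twistInr A P) ⊗ₘ twistInl A P) =
    p ▷ A ≫ (twistInr A P ⊗ₘ twistInl A P) := by simp [MonoidalCategory.tensorHom_def]
  have e2 : (twistInl A P ⊗ₘ (p ≫ twistInr A P)) =
    A ◁ p ≫ (twistInl A P ⊗ₘ twistInr A P) := by simp [tensorHom_def']
  unfold HalfBraid.Compat at hp
  rw [e1, e2, Category.assoc, Category.assoc, twistInr_twistInl, twistInl_twistInr b h1, hp, hr,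
    Category.comp_id]

variable {B : C} [MonObj B] (a : A ⟶ B) (F : P ⟶ B)

theorem twistOne_comp_conv [IsMonHom a] [IsMonHom F] : twistOne A P ≫ a ⋆ F = η[B] := by
  rw [twistOne, Category.assoc, Category.assoc, whiskerLeft_conv, whiskerRight_conv,
    IsMonHom.one_hom, IsMonHom.one_hom, one_conv, Iso.inv_hom_id_assoc]

theorem twistInl_comp_conv {X : C} (a : X ⟶ B) (F : P ⟶ B) [IsMonHom F] :
    twistInl X P ≫ a ⋆ F = a := by
  rw [twistInl, Category.assoc, whiskerLeft_conv, IsMonHom.one_hom, conv_one,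
    Iso.inv_hom_id_assoc]

theorem twistInr_comp_conv {X : C} (a : A ⟶ B) (F : X ⟶ B) [IsMonHom a] :
    twistInr A X ≫ a ⋆ F = F := by
  rw [twistInr, Category.assoc, whiskerRight_conv, IsMonHom.one_hom, one_conv,
    Iso.inv_hom_id_assoc]

/-- Expand the product of two copies of `a ⋆ F` to `a F a F`, exchange the middle pair by `h`, and
merge equal neighbours by multiplicativity. -/
theorem twistMul_comp_conv [IsMonHom a] [IsMonHom F] (l : P ⊗ A ⟶ A ⊗ P)
    (h : F ⋆ a = l ≫ a ⋆ F) :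
    twistMul l ≫ a ⋆ F = ((a ⋆ F) ⊗ₘ (a ⋆ F)) ≫ μ[B] := by
  change _ = (a ⋆ F) ⋆ (a ⋆ F)
  rw [conv_assoc, conv_assoc' F a F, h, ← whiskerRight_conv, conv_assoc a F F,
    ← mul_comp_eq_conv F, ← whiskerLeft_conv a, ← whiskerLeft_conv a, ← whiskerLeft_conv a,
    conv_assoc' a a, ← mul_comp_eq_conv a, ← whiskerRight_conv, ← whiskerLeft_conv a]
  simp only [twistMul, Category.assoc]

theorem tensor_braid_conv {X Y : C} (b : HalfBraid R X) (c : HalfBraid R Y) (x : X ⟶ B)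
    (y : Y ⟶ B) (hx : x ⋆ a = b.β ≫ a ⋆ x) (hy : y ⋆ a = c.β ≫ a ⋆ y) :
    (x ⋆ y) ⋆ a = (b.tensor c).β ≫ a ⋆ x ⋆ y := by
  rw [conv_assoc, hy, ← whiskerLeft_conv, conv_assoc' x a y, hx, ← whiskerRight_conv,
    conv_assoc a x y]
  simp [HalfBraid.tensor]

end Twist

variable (M : QuasiCommMon C)

/-- The half-braiding of a quasi-commutative monoid with itself. -/
def selfBraid : HalfBraid M.R.hom M.toMon.X where
  β := M.R.hom
  one := by simpa using congrArg ((ρ_ _).hom ≫ ·) M.one_right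
  mul := M.mul_right
  yang_baxter := by
    have := M.yang_baxter
    rw [← cancel_mono (α_ _ _ _).hom] at this
    simpa using this.symm

/-- A monoid structure on `X` compatible with a half-braiding. -/
structure BraidedMon (X : C) where
  /-- the monoid structure -/
  mon : MonObj X
  /-- the half-braiding -/
  braid : HalfBraid M.R.hom X
  one_compat : HalfBraid.Compat (HalfBraid.unit _) braid η[X]
  mul_compat : HalfBraid.Compat (braid.tensor braid) braid μ[X]

theorem selfBraid_one_compat :
    HalfBraid.Compat (HalfBraid.unit _) (selfBraid M) η[M.toMon.X] := by
  have := congrArg ((λ_ _).hom ≫ ·) M.one_left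
  simpa [HalfBraid.Compat, selfBraid, HalfBraid.unit] using this

theorem selfBraid_mul_compat :
    HalfBraid.Compat ((selfBraid M).tensor (selfBraid M)) (selfBraid M) μ[M.toMon.X] := by
  simpa [HalfBraid.Compat, selfBraid, HalfBraid.tensor] using M.mul_left

/-- This is the Yang-Baxter law of `b` read as a property of the morphism `b.β`. It allows the
twisted product to be iterated. -/
theorem compat_braid {X : C} (b : HalfBraid M.R.hom X) :
    HalfBraid.Compat (b.tensor (selfBraid M)) ((selfBraid M).tensor b) b.β := by
  have := b.yang_baxter
  simp only [HalfBraid.Compat, selfBraid, HalfBraid.tensor, Category.assoc]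
  exact this.symm

namespace BraidedMon

variable {M}

/-- The twisted tensor product. -/
def twist {P : C} (T : BraidedMon M P) : BraidedMon M (M.toMon.X ⊗ P) :=
  letI := T.mon
  { mon :=
      { one := twistOne M.toMon.X P
        mul := twistMul T.braid.β
        one_mul := twist_one_mul _ T.one_compat
        mul_one := twist_mul_one _
        mul_assoc := twist_mul_assoc _ T.mul_compat }
    braid := (selfBraid M).tensor T.braid
    one_compat :=
      ((HalfBraid.Compat.leftUnitor (HalfBraid.unit _)).inv (f := λ_ _)).comp
        (((selfBraid_one_compat M).whiskerRight _).comp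
          (HalfBraid.Compat.whiskerLeft _ T.one_compat))
    -- The multiplication is a composite of associators, `β`, `μ[A]` and `μ[P]`, and each of them
    -- respects the half-braidings.
    mul_compat :=
      (HalfBraid.Compat.associator _ _ _).comp <|
        (HalfBraid.Compat.whiskerLeft _
          ((HalfBraid.Compat.associator _ _ _).inv (f := α_ _ _ _))).comp <|
        (HalfBraid.Compat.whiskerLeft _ ((compat_braid M T.braid).whiskerRight T.braid)).comp <|
        (HalfBraid.Compat.whiskerLeft _ (HalfBraid.Compat.associator _ _ _)).comp <|
        ((HalfBraid.Compat.associator _ _ _).inv (f := α_ _ _ _)).comp <|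
        ((selfBraid_mul_compat M).whiskerRight _).comp <|
        HalfBraid.Compat.whiskerLeft _ T.mul_compat }

variable (M) in
/-- The trivial monoid. -/
def trivial : BraidedMon M (𝟙_ C) where
  mon := inferInstance
  braid := HalfBraid.unit _
  one_compat := by simp [HalfBraid.Compat]
  mul_compat := HalfBraid.Compat.leftUnitor _

variable (M) in
/-- The iterated twisted tensor powers. -/
def power : (n : ℕ) → BraidedMon M (tensorFam n fun _ => M.toMon.X)
  | 0 => trivial M
  | n + 1 => (power n).twist

end BraidedMon

end Tower

/-! ### The universal property of the twisted tensor powers. -/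

section Power

open MonObj

variable {C : Type u} [Category.{v} C] [MonoidalCategory C]

local infixr:81 " ⋆ " => conv

/-- Two morphisms from a quasi-commutative monoid to a monoid commute up to `R`. -/
def RComm (M : QuasiCommMon C) {B : Mon C} (f g : M.toMon ⟶ B) : Prop :=
  f.hom ⋆ g.hom = M.R.hom ≫ g.hom ⋆ f.hom

namespace RComm

variable {M : QuasiCommMon C} {B B' : Mon C}

theorem refl (f : M.toMon ⟶ B) : RComm M f f := by
  rw [RComm, ← mul_comp_eq_conv, reassoc_of% M.quasi_comm]

/-- `R² = I` enters here: without it only pairs in one order would commute, and non-monotone maps of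
indices would induce nothing. -/
theorem symm (hR : QuasiCommMon.isNearlyComm M) {f g : M.toMon ⟶ B} (h : RComm M f g) :
    RComm M g f := by
  have hR : M.R.hom ≫ M.R.hom = 𝟙 _ := hR
  rw [RComm] at *
  rw [h, reassoc_of% hR]

theorem comp {f g : M.toMon ⟶ B} (h : RComm M f g) (t : B ⟶ B') :
    RComm M (f ≫ t) (g ≫ t) := by
  rw [RComm] at *
  rw [Mon.comp_hom', Mon.comp_hom', ← conv_comp, ← conv_comp, h, Category.assoc]

theorem precomp {M' : QuasiCommMon C} (u : M' ⟶ M) {f g : M.toMon ⟶ B} (h : RComm M f g) :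
    RComm M' (u.hom ≫ f) (u.hom ≫ g) := by
  have hu : M'.R.hom ≫ (u.hom.hom ⊗ₘ u.hom.hom) = (u.hom.hom ⊗ₘ u.hom.hom) ≫ M.R.hom := u.comm
  rw [RComm] at *
  rw [Mon.comp_hom', Mon.comp_hom', ← tensorHom_conv, ← tensorHom_conv, h, reassoc_of% hu]

end RComm

/-- The product of a finite family of homomorphisms of monoids. -/
abbrev homProd {A B : Mon C} {n : ℕ} (f : Fin n → (A ⟶ B)) :
    tensorFam n (fun _ => A.X) ⟶ B.X :=
  famProd B n fun i => (f i).hom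

theorem homProd_comp {A B B' : Mon C} {n : ℕ} (f : Fin n → (A ⟶ B)) (t : B ⟶ B') :
    homProd f ≫ t.hom = homProd (fun i => f i ≫ t) :=
  famProd_comp _ _ _

variable (M : QuasiCommMon C)

/-- The iterated twisted tensor power as a monoid. -/
def powerMon (n : ℕ) : Mon C where
  X := tensorFam n fun _ => M.toMon.X
  mon := (BraidedMon.power M n).mon

/-- The inclusion of the first factor of a twisted tensor power. -/
def powerInl (n : ℕ) : M.toMon ⟶ powerMon M (n + 1) :=
  @Mon.Hom.mk _ _ _ _ (powerMon M (n + 1)) (twistInl M.toMon.X (powerMon M n).X)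
    { one_hom := one_twistInl
      mul_hom := twistInl_mul (P := (powerMon M n).X) _ (BraidedMon.power M n).one_compat }

/-- The inclusion of the last factors of a twisted tensor power. -/
def powerInr (n : ℕ) : powerMon M n ⟶ powerMon M (n + 1) :=
  @Mon.Hom.mk _ _ _ (powerMon M n) (powerMon M (n + 1)) (twistInr M.toMon.X (powerMon M n).X)
    { one_hom := one_twistInr
      mul_hom := twistInr_mul (P := (powerMon M n).X) _ }

theorem powerInl_conv_powerInr (n : ℕ) :
    (powerInl M n).hom ⋆ (powerInr M n).hom = 𝟙 _ :=
  twistInl_twistInr (P := (powerMon M n).X) _ (BraidedMon.power M n).one_compat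

/-- The inclusions of the factors of a twisted tensor power. -/
def powerIncl : (n : ℕ) → Fin n → (M.toMon ⟶ powerMon M n)
  | 0 => Fin.elim0
  | n + 1 => Fin.cases (powerInl M n) (fun k => powerIncl n k ≫ powerInr M n)

theorem homProd_powerIncl (n : ℕ) : homProd (powerIncl M n) = 𝟙 _ := by
  induction n with
  | zero => exact famProd_zero _ _
  | succ n ih =>
    have e := homProd_comp (powerIncl M n) (powerInr M n)
    rw [ih] at e
    refine (famProd_succ _ _ _).trans (Eq.trans ?_ (powerInl_conv_powerInr M n))
    exact congrArg (fun t => conv (powerInl M n).hom t) (e.symm.trans (Category.id_comp _))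

theorem powerIncl_compat (n : ℕ) (k : Fin n) :
    HalfBraid.Compat (selfBraid M) (BraidedMon.power M n).braid (powerIncl M n k).hom := by
  induction n with
  | zero => exact k.elim0
  | succ n ih =>
    refine Fin.cases ?_ (fun k => ?_) k
    · exact ((HalfBraid.Compat.rightUnitor _).inv (f := ρ_ _)).comp
        (HalfBraid.Compat.whiskerLeft _ (BraidedMon.power M n).one_compat)
    · exact (ih k).comp (((HalfBraid.Compat.leftUnitor _).inv (f := λ_ _)).comp
        ((selfBraid_one_compat M).whiskerRight _))

variable {M}

theorem powerIncl_rComm (hR : QuasiCommMon.isNearlyComm M) (n : ℕ) (k l : Fin n) :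
    RComm M (powerIncl M n k) (powerIncl M n l) := by
  induction n with
  | zero => exact k.elim0
  | succ n ih =>
    -- A later factor followed by the first one is handled by the twist directly; the opposite order
    -- then follows from symmetry.
    have key (k : Fin n) : RComm M (powerIncl M (n + 1) k.succ) (powerIncl M (n + 1) 0) := 
      twist_rComm (P := (powerMon M n).X) _ (BraidedMon.power M n).one_compat (selfBraid M) rfl _
        (powerIncl_compat M n k)
    refine Fin.cases ?_ (fun k => ?_) k <;> refine Fin.cases ?_ (fun l => ?_) l
    · exact RComm.refl _
    · exact (key l).symm hR
    · exact key k
    · exact (ih k l).comp _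

/-- Moving `h` past the factors one at a time composes copies of `R` into the half-braiding of the
power. This is the exchange relation required by `twistMul_comp_conv`. -/
theorem homProd_conv {B : Mon C} {n : ℕ} (f : Fin n → (M.toMon ⟶ B)) (h : M.toMon ⟶ B)
    (hf : ∀ k, RComm M (f k) h) :
    homProd f ⋆ h.hom = (BraidedMon.power M n).braid.β ≫ h.hom ⋆ homProd f := by
  induction n with
  | zero =>
    rw [homProd, famProd_zero]
    erw [one_conv, conv_one]
    exact (congrArg ((λ_ M.toMon.X).hom ≫ ·) ((ρ_ M.toMon.X).inv_hom_id_assoc h.hom).symm).trans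
      (Category.assoc _ _ _).symm
  | succ n ih =>
    rw [homProd, famProd_succ]
    exact tensor_braid_conv h.hom (selfBraid M) (BraidedMon.power M n).braid _ _ (hf 0)
      (ih (fun k => f k.succ) fun k => hf k.succ)

theorem isMonHom_homProd {B : Mon C} {n : ℕ} (f : Fin n → (M.toMon ⟶ B))
    (hf : ∀ k l, RComm M (f k) (f l)) : IsMonHom (M := (powerMon M n).X) (homProd f) := by
  induction n with
  | zero =>
    rw [homProd, famProd_zero]
    exact inferInstanceAs (IsMonHom ((Mon.uniqueHomFromTrivial B).default.hom))
  | succ n ih =>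
    have := ih (fun k => f k.succ) (fun k l => hf k.succ l.succ)
    have s := homProd_conv (fun k => f k.succ) (f 0) (fun k => hf k.succ 0)
    rw [homProd, famProd_succ]
    exact ⟨twistOne_comp_conv (P := (powerMon M n).X) _ _,
      twistMul_comp_conv (P := (powerMon M n).X) _ _ _ s⟩

/-- The homomorphism from a twisted tensor power given by a commuting family. -/
def powerDesc {B : Mon C} {n : ℕ} (f : Fin n → (M.toMon ⟶ B))
    (hf : ∀ k l, RComm M (f k) (f l)) : powerMon M n ⟶ B :=
  @Mon.Hom.mk _ _ _ (powerMon M n) B (homProd f) (isMonHom_homProd f hf)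

theorem powerInl_homProd {B : Mon C} {n : ℕ} (f : Fin (n + 1) → (M.toMon ⟶ B))
    (hf : ∀ k l, RComm M (f k) (f l)) : (powerInl M n).hom ≫ homProd f = (f 0).hom := by
  have := isMonHom_homProd (fun k => f k.succ) (fun k l => hf k.succ l.succ)
  rw [homProd, famProd_succ]
  exact twistInl_comp_conv (P := (powerMon M n).X) _ _

theorem powerInr_homProd {B : Mon C} {n : ℕ} (f : Fin (n + 1) → (M.toMon ⟶ B)) :
    (powerInr M n).hom ≫ homProd f = homProd (fun k => f k.succ) := by
  rw [homProd, famProd_succ]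
  exact twistInr_comp_conv (X := (powerMon M n).X) _ _

theorem powerIncl_homProd {B : Mon C} {n : ℕ} (f : Fin n → (M.toMon ⟶ B))
    (hf : ∀ k l, RComm M (f k) (f l)) (k : Fin n) :
    (powerIncl M n k).hom ≫ homProd f = (f k).hom := by
  induction n with
  | zero => exact k.elim0
  | succ n ih =>
    refine Fin.cases ?_ (fun k => ?_) k
    · exact powerInl_homProd f hf
    · refine (Category.assoc _ _ _).trans ?_
      rw [powerInr_homProd]
      exact ih (fun k => f k.succ) (fun k l => hf k.succ l.succ) k

end Power

/-! ### Covers, words, and a criterion for the covering condition. -/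

section Cover

open MonObj

variable {C : Type u} [Category.{v} C] [MonoidalCategory C]

local infixr:81 " ⋆ " => conv

/-- A commuting family of homomorphisms from a quasi-commutative monoid to a monoid, whose product
is an isomorphism. -/
structure IsCover (M : QuasiCommMon C) {n : ℕ} {B : Mon C} (j : Fin n → (M.toMon ⟶ B)) :
    Prop where
  comm : ∀ k l, RComm M (j k) (j l)
  isIso : IsIso (homProd j)

namespace IsCover

variable {M : QuasiCommMon C} {n : ℕ} {B B' : Mon C} {j : Fin n → (M.toMon ⟶ B)}

theorem hom_ext (hj : IsCover M j) {g g' : B ⟶ B'} (h : ∀ k, j k ≫ g = j k ≫ g') : g = g' := by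
  have := hj.isIso
  apply Mon.Hom.ext
  rw [← cancel_epi (homProd j), homProd_comp, homProd_comp, funext h]

/-- The homomorphism `powerDesc j` is invertible, so `B` inherits the universal property of the
twisted power. -/
theorem exists_desc (hj : IsCover M j) (f : Fin n → (M.toMon ⟶ B'))
    (hf : ∀ k l, RComm M (f k) (f l)) : ∃ g : B ⟶ B', ∀ k, j k ≫ g = f k := by
  have : IsIso ((Mon.forget C).map (powerDesc j hj.comm)) := hj.isIso
  have : IsIso (powerDesc j hj.comm) := isIso_of_reflects_iso _ (Mon.forget C)
  refine ⟨inv (powerDesc j hj.comm) ≫ powerDesc f hf, fun k => ?_⟩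
  have e : powerIncl M n k ≫ powerDesc j hj.comm = j k :=
    Mon.Hom.ext (powerIncl_homProd j hj.comm k)
  rw [← e, Category.assoc, IsIso.hom_inv_id_assoc]
  exact Mon.Hom.ext (powerIncl_homProd f hf k)

/-- The homomorphism given by a commuting family. -/
noncomputable def desc (hj : IsCover M j) (f : Fin n → (M.toMon ⟶ B'))
    (hf : ∀ k l, RComm M (f k) (f l)) : B ⟶ B' :=
  (hj.exists_desc f hf).choose

theorem fac (hj : IsCover M j) (f : Fin n → (M.toMon ⟶ B'))
    (hf : ∀ k l, RComm M (f k) (f l)) (k : Fin n) : j k ≫ hj.desc f hf = f k :=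
  (hj.exists_desc f hf).choose_spec k

end IsCover

theorem isCover_powerIncl {M : QuasiCommMon C} (hR : QuasiCommMon.isNearlyComm M) (n : ℕ) :
    IsCover M (powerIncl M n) where
  comm := powerIncl_rComm hR n
  isIso := by
    rw [homProd_powerIncl]
    exact inferInstanceAs (IsIso (𝟙 (tensorFam n fun _ => M.toMon.X)))

theorem isCover_id (M : QuasiCommMon C) : IsCover M (fun _ : Fin 1 => 𝟙 M.toMon) where
  comm _ _ := RComm.refl _
  isIso := by
    rw [homProd, famProd_succ, famProd_zero]
    have h : IsIso (𝟙 M.toMon.X ⋆ η[M.toMon.X]) := by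
      rw [conv_one]
      infer_instance
    exact h

section Words

variable {A B B' : Mon C} {n : ℕ}

/-- The product of the entries of a word in a finite family of homomorphisms. -/
def wordProd (j : Fin n → (A ⟶ B)) :
    (w : List (Fin n)) → (tensorFam w.length (fun _ => A.X) ⟶ B.X)
  | [] => η[B.X]
  | k :: w => (j k).hom ⋆ wordProd j w

/-- A morphism which is, up to an isomorphism of the source, the product of a word. -/
def IsWordProd (j : Fin n → (A ⟶ B)) (w : List (Fin n)) {X : C} (x : X ⟶ B.X) : Prop :=
  ∃ e : X ≅ tensorFam w.length (fun _ => A.X), x = e.hom ≫ wordProd j w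

namespace IsWordProd

variable {j : Fin n → (A ⟶ B)} {w w' : List (Fin n)} {X Y : C} {x : X ⟶ B.X} {y : Y ⟶ B.X}

theorem wordProd (j : Fin n → (A ⟶ B)) (w : List (Fin n)) :
    IsWordProd j w (wordProd j w) := ⟨Iso.refl _, (Category.id_comp _).symm⟩

theorem nil (j : Fin n → (A ⟶ B)) : IsWordProd j [] η[B.X] := wordProd j []

theorem precomp (e : Y ≅ X) (h : IsWordProd j w x) : IsWordProd j w (e.hom ≫ x) := by
  obtain ⟨e', rfl⟩ := h
  exact ⟨e ≪≫ e', by simp⟩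

theorem cons (k : Fin n) (h : IsWordProd j w x) : IsWordProd j (k :: w) ((j k).hom ⋆ x) := by
  obtain ⟨e, rfl⟩ := h
  rw [← whiskerLeft_conv]
  exact ⟨whiskerLeftIso _ e, rfl⟩

theorem append (h : IsWordProd j w x) (h' : IsWordProd j w' y) :
    IsWordProd j (w ++ w') (x ⋆ y) := by
  obtain ⟨e, rfl⟩ := h
  rw [← whiskerRight_conv]
  refine precomp (whiskerRightIso e Y) ?_
  clear e
  induction w with
  | nil =>
    have : NearlyComm.wordProd j [] ⋆ y = (λ_ Y).hom ≫ y := one_conv y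
    rw [this]
    exact precomp _ h'
  | cons k w ih =>
    have : NearlyComm.wordProd j (k :: w) ⋆ y = _ := conv_assoc _ _ _
    rw [this]
    exact precomp (α_ _ _ _) (ih.cons k)

theorem famProd {m : ℕ} {X : Fin m → C} {x : ∀ i, X i ⟶ B.X} {w : Fin m → List (Fin n)}
    (h : ∀ i, IsWordProd j (w i) (x i)) :
    IsWordProd j (List.ofFn w).flatten (famProd B m x) := by
  induction m with
  | zero =>
    rw [famProd_zero]
    exact nil j
  | succ m ih =>
    rw [famProd_succ, List.ofFn_succ, List.flatten_cons]
    exact (h 0).append (ih fun i => h i.succ)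

theorem comp (h : IsWordProd j w x) (t : B ⟶ B') :
    IsWordProd (fun k => j k ≫ t) w (x ≫ t.hom) := by
  obtain ⟨e, rfl⟩ := h
  rw [Category.assoc]
  refine precomp e ?_
  clear e
  induction w with
  | nil =>
    have : NearlyComm.wordProd j [] ≫ t.hom = η[B'.X] := IsMonHom.one_hom _
    rw [this]
    exact nil _
  | cons k w ih =>
    have : NearlyComm.wordProd j (k :: w) ≫ t.hom = _ := conv_comp _ _ _
    rw [this]
    exact ih.cons (j := fun k => j k ≫ t) k

theorem map {m : ℕ} {f : Fin n → Fin m} {j : Fin m → (A ⟶ B)}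
    (h : IsWordProd (fun k => j (f k)) w x) : IsWordProd j (w.map f) x := by
  obtain ⟨e, rfl⟩ := h
  refine precomp e ?_
  clear e
  induction w with
  | nil => exact nil j
  | cons k w ih => exact ih.cons (f k)

theorem isIso [IsIso x] (h : IsWordProd j w x) (h' : IsWordProd j w y) : IsIso y := by
  obtain ⟨e, rfl⟩ := h
  obtain ⟨e', rfl⟩ := h'
  have := IsIso.of_isIso_comp_left e.hom (NearlyComm.wordProd j w)
  infer_instance

theorem homProd {n : ℕ} (j : Fin n → (A ⟶ B)) : IsWordProd j (List.finRange n) (homProd j) := by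
  induction n with
  | zero =>
    rw [NearlyComm.homProd, famProd_zero]
    exact nil j
  | succ n ih =>
    rw [NearlyComm.homProd, famProd_succ, List.finRange_succ]
    exact (ih fun k => j k.succ).map.cons 0

end IsWordProd

theorem exists_perm_of_nodup {n : ℕ} {w : List (Fin n)} (h : w.Nodup) (h' : ∀ k, k ∈ w) :
    ∃ π : Equiv.Perm (Fin n), w = (List.finRange n).map π := by
  have hp : w.Perm (List.finRange n) :=
    (List.perm_ext_iff_of_nodup h (List.nodup_finRange n)).2 fun k => by simp [h']
  have hl : w.length = n := by simpa using hp.length_eq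
  have hinj : Function.Injective fun i : Fin n => w.get (i.cast hl.symm) := fun a b hab => by
    simpa using (List.nodup_iff_injective_get.1 h) hab
  refine ⟨Equiv.ofBijective _ (Finite.injective_iff_bijective.1 hinj), ?_⟩
  apply List.ext_getElem
  · simp [hl]
  · intro i h1 h2
    simp

end Words

/-- Up to an isomorphism of sources, a covering map is the product of the `j l x` in the order in
which the family lists the points `x` of `[n]`. Each point is listed once, so this order is a
permutation of the increasing one, and a permutation is realised by an automorphism. -/
theorem coveringCondition_of_isIso {A : Mon C} {N : ℕ∞} (F : FinOrd N ⥤ Mon C)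
    (j : ∀ k : FinOrd N, Fin k.len → (A ⟶ F.obj k)) (hj : ∀ k, IsIso (homProd (j k)))
    (hF : ∀ (k l : FinOrd N) (f : k ⟶ l) (i : Fin k.len),
      j k i ≫ F.map f = j l ((show Fin k.len →o Fin l.len from f) i))
    (hπ : ∀ (k : FinOrd N) (π : Equiv.Perm (Fin k.len)),
      ∃ t : F.obj k ⟶ F.obj k, IsIso t ∧ ∀ i, j k i ≫ t = j k (π i)) :
    CoveringCondition F := by
  intro m k l f hf
  have h1 (i : Fin m) : IsWordProd (j l) ((List.finRange (k i).len).map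
      (show Fin (k i).len →o Fin l.len from f i)) (F.map (f i)).hom := by
    have := hj (k i)
    have h := ((IsWordProd.homProd (j (k i))).precomp (asIso (homProd (j (k i)))).symm).comp
      (F.map (f i))
    simp only [Iso.symm_hom, asIso_inv, IsIso.inv_hom_id, hF] at h
    rw [Category.id_comp] at h
    exact h.map
  have h2 := IsWordProd.famProd h1
  obtain ⟨π, hw⟩ := exists_perm_of_nodup
    (w := (List.ofFn fun i => (List.finRange (k i).len).map
      (show Fin (k i).len →o Fin l.len from f i)).flatten)
    -- Injectivity excludes repetitions within a block, disjointness those between blocks;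
    -- surjectivity below comes from `hf.cover`.
    (List.nodup_flatten.2 ⟨by
      intro w hw
      obtain ⟨i, rfl⟩ := (List.mem_ofFn' _ _).1 hw
      exact (List.nodup_finRange _).map (hf.injective i), by
      rw [List.pairwise_ofFn]
      intro i i' hi x hx hx'
      obtain ⟨a, -, ha⟩ := List.mem_map.1 hx
      obtain ⟨b, -, hb⟩ := List.mem_map.1 hx'
      exact Set.disjoint_left.1 (hf.disjoint i i' hi.ne) ⟨a, ha⟩ ⟨b, hb⟩⟩)
    (fun x => by
      have hx : x ∈ ⋃ i, Set.range (show Fin (k i).len →o Fin l.len from f i) := by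
        rw [hf.cover]; trivial
      obtain ⟨i, a, ha⟩ := Set.mem_iUnion.1 hx
      exact List.mem_flatten.2 ⟨_, (List.mem_ofFn' _ _).2 ⟨i, rfl⟩,
        List.mem_map.2 ⟨a, List.mem_finRange a, ha⟩⟩)
  rw [hw] at h2
  -- Composing the invertible increasing product with `t` gives an invertible product over the same
  -- word as the covering map.
  obtain ⟨t, ht, hjt⟩ := hπ l π
  have h3 := (IsWordProd.homProd (j l)).comp t
  simp only [hjt] at h3
  have := hj l
  exact h3.map.isIso h2

end Cover

/-! ### The complex of a nearly commutative monoid. -/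

section Complex

variable {C : Type u} [Category.{v} C] [MonoidalCategory C]

variable (M : QuasiCommMon C)

/-- The monoids of the complex of a nearly commutative monoid. -/
def cplxMon (M : QuasiCommMon C) : ℕ → Mon C
  -- `powerMon M 1` is `A ⊗ 1`, only isomorphic to `A`; the exceptional case makes `A^1 = A` hold
  -- strictly.
  | 1 => M.toMon
  | n => powerMon M n

/-- The canonical homomorphisms `A^1 ⟶ A^n` of the complex of a nearly commutative monoid. -/
def cplxIncl : (n : ℕ) → Fin n → (M.toMon ⟶ cplxMon M n)
  | 0 => powerIncl M 0
  | 1 => fun _ => 𝟙 M.toMon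
  | n + 2 => powerIncl M (n + 2)

variable {M}

theorem isCover_cplxIncl (hR : QuasiCommMon.isNearlyComm M) :
    (n : ℕ) → IsCover M (cplxIncl M n)
  | 0 => isCover_powerIncl hR 0
  | 1 => isCover_id M
  | n + 2 => isCover_powerIncl hR (n + 2)

/-- The homomorphism of the complex induced by a map of sets. -/
noncomputable def cplxMap (hR : QuasiCommMon.isNearlyComm M) {m n : ℕ} (f : Fin m → Fin n) :
    cplxMon M m ⟶ cplxMon M n :=
  (isCover_cplxIncl hR m).desc (fun k => cplxIncl M n (f k))
    fun _ _ => (isCover_cplxIncl hR n).comm _ _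

section

variable (hR : QuasiCommMon.isNearlyComm M)

theorem cplxIncl_map {m n : ℕ} (f : Fin m → Fin n) (k : Fin m) :
    cplxIncl M m k ≫ cplxMap hR f = cplxIncl M n (f k) :=
  (isCover_cplxIncl hR m).fac _ _ k

theorem cplxMap_id (n : ℕ) : cplxMap hR (fun k : Fin n => k) = 𝟙 _ :=
  (isCover_cplxIncl hR n).hom_ext fun k => by rw [cplxIncl_map, Category.comp_id]

theorem cplxMap_comp {l m n : ℕ} (f : Fin l → Fin m) (g : Fin m → Fin n) :
    cplxMap hR f ≫ cplxMap hR g = cplxMap hR (fun k => g (f k)) :=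
  (isCover_cplxIncl hR l).hom_ext fun k => by
    rw [reassoc_of% cplxIncl_map hR f k, cplxIncl_map, cplxIncl_map]

/-- The symmetric group action on the complex of a nearly commutative monoid. -/
noncomputable def cplxAct (n : ℕ) : Equiv.Perm (Fin n) →* Aut (cplxMon M n) where
  toFun π :=
    { hom := cplxMap hR π
      inv := cplxMap hR π.symm
      hom_inv_id := by
        rw [cplxMap_comp]
        simpa using cplxMap_id hR n
      inv_hom_id := by
        rw [cplxMap_comp]
        simpa using cplxMap_id hR n }
  map_one' := Iso.ext (cplxMap_id hR n)
  map_mul' π π' := Iso.ext (cplxMap_comp hR π' π).symm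

/-- The symmetric cosimplicial monoid of a nearly commutative monoid. -/
noncomputable def symCplx (N : ℕ∞) : SymCosimplicialMon C N where
  F :=
    { obj := fun k => cplxMon M k.len
      map := fun {k l} f => cplxMap hR (show Fin k.len →o Fin l.len from f)
      map_id := fun k => cplxMap_id hR k.len
      map_comp := fun {k l m} f g =>
        (cplxMap_comp hR (show Fin k.len →o Fin l.len from f)
          (show Fin l.len →o Fin m.len from g)).symm }
  act k := cplxAct hR k.len
  -- Arbitrary maps of sets act functorially, so the equality `π f = f' π'` is all that is needed.
  compat k l f f' π π' h _ := by
    change cplxMap hR f ≫ cplxMap hR π = cplxMap hR π' ≫ cplxMap hR f'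
    rw [cplxMap_comp, cplxMap_comp]
    simp only [h]

/-- The symmetric cosimplicial monoid of a nearly commutative monoid satisfies the covering
condition. -/
noncomputable def coveringCplx (N : ℕ∞) : SymCoveringMon C N where
  obj := symCplx hR N
  property := coveringCondition_of_isIso _ (fun k => cplxIncl M k.len)
    (fun k => (isCover_cplxIncl hR k.len).isIso)
    (fun _ _ _ i => cplxIncl_map hR _ i)
    (fun k π => ⟨((cplxAct hR k.len) π).hom, Iso.isIso_hom (cplxAct hR k.len π),
      fun i => cplxIncl_map hR _ i⟩)

end

end Complex

/-! ### From complexes to nearly commutative monoids. -/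

section Forward

open MonObj

variable {C : Type u} [Category.{v} C] [MonoidalCategory C]

local infixr:81 " ⋆ " => conv

section Generic

variable {A B : C} [MonObj A] [MonObj B] (R : A ⊗ A ⟶ A ⊗ A) {x y z : A ⟶ B}

/-- In this and the next three lemmas, composing with the monomorphism `y ⋆ x` turns the law for `R`
into an identity between products in `B`, where `x` is moved past `y` by `h`. -/
theorem one_left_of_comm [IsMonHom x] [IsMonHom y] [Mono (y ⋆ x)] (h : x ⋆ y = R ≫ y ⋆ x) :
    (λ_ A).inv ≫ (η[A] ▷ A) ≫ R = (ρ_ A).inv ≫ (A ◁ η[A]) := by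
  rw [← cancel_mono (y ⋆ x)]
  simp only [Category.assoc]
  rw [← h, whiskerRight_conv, whiskerLeft_conv]
  simp

theorem one_right_of_comm [IsMonHom x] [IsMonHom y] [Mono (y ⋆ x)] (h : x ⋆ y = R ≫ y ⋆ x) :
    (ρ_ A).inv ≫ (A ◁ η[A]) ≫ R = (λ_ A).inv ≫ (η[A] ▷ A) := by
  rw [← cancel_mono (y ⋆ x)]
  simp only [Category.assoc]
  rw [← h, whiskerRight_conv, whiskerLeft_conv]
  simp

theorem mul_right_of_comm [IsMonHom x] [IsMonHom y] [Mono (y ⋆ x)] (h : x ⋆ y = R ≫ y ⋆ x) :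
    (A ◁ μ[A]) ≫ R = (α_ A A A).inv ≫ (R ▷ A) ≫ (α_ A A A).hom ≫ (A ◁ R) ≫
      (α_ A A A).inv ≫ (μ[A] ▷ A) := by
  rw [← cancel_mono (y ⋆ x)]
  simp only [Category.assoc]
  rw [← h, whiskerRight_conv, whiskerLeft_conv, mul_comp_eq_conv,
    conv_assoc' x, h, ← whiskerRight_conv, conv_assoc y, h, ← whiskerLeft_conv, conv_assoc' y y]

theorem mul_left_of_comm [IsMonHom x] [IsMonHom y] [Mono (y ⋆ x)] (h : x ⋆ y = R ≫ y ⋆ x) :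
    (μ[A] ▷ A) ≫ R = (α_ A A A).hom ≫ (A ◁ R) ≫ (α_ A A A).inv ≫ (R ▷ A) ≫
      (α_ A A A).hom ≫ (A ◁ μ[A]) := by
  rw [← cancel_mono (y ⋆ x)]
  simp only [Category.assoc]
  rw [← h, whiskerRight_conv, whiskerLeft_conv, mul_comp_eq_conv,
    conv_assoc x x, h, ← whiskerLeft_conv x, conv_assoc' x y, h, ← whiskerRight_conv R,
    conv_assoc y x]

/-- The two sides are the two ways of reversing the product `x y z` to `z y x` by adjacent
exchanges. -/
theorem yang_baxter_of_comm {A : C} {R : A ⊗ A ⟶ A ⊗ A} {x y z : A ⟶ B} [Mono (z ⋆ y ⋆ x)] (hxy : x ⋆ y = R ≫ y ⋆ x)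
    (hyz : y ⋆ z = R ≫ z ⋆ y) (hxz : x ⋆ z = R ≫ z ⋆ x) :
    (R ▷ A) ≫ (α_ A A A).hom ≫ (A ◁ R) ≫ (α_ A A A).inv ≫ (R ▷ A) =
      (α_ A A A).hom ≫ (A ◁ R) ≫ (α_ A A A).inv ≫ (R ▷ A) ≫ (α_ A A A).hom ≫ (A ◁ R) ≫
        (α_ A A A).inv := by
  rw [← cancel_mono (α_ A A A).hom, ← cancel_mono (z ⋆ y ⋆ x)]
  simp only [Category.assoc, Iso.inv_hom_id_assoc]
  have h1 : (x ⋆ y) ⋆ z = (α_ A A A).hom ≫ (A ◁ R) ≫ (α_ A A A).inv ≫ (R ▷ A) ≫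
      (α_ A A A).hom ≫ (A ◁ R) ≫ z ⋆ y ⋆ x := by
    rw [conv_assoc, hyz, ← whiskerLeft_conv, conv_assoc' x z, hxz, ← whiskerRight_conv,
      conv_assoc z x, hxy, ← whiskerLeft_conv]
  have h2 : (x ⋆ y) ⋆ z = (R ▷ A) ≫ (α_ A A A).hom ≫ (A ◁ R) ≫ (α_ A A A).inv ≫ (R ▷ A) ≫
      (α_ A A A).hom ≫ z ⋆ y ⋆ x := by
    rw [hxy, ← whiskerRight_conv, conv_assoc, hxz, ← whiskerLeft_conv, conv_assoc' y z, hyz,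
      ← whiskerRight_conv, conv_assoc z y]
  rw [← h1, ← h2]

end Generic

namespace SymCoveringMon

variable {N : ℕ∞} (hN : 3 ≤ N) (X : SymCoveringMon C N)

/-- The map `[1] ⟶ [n]` with image `i`. -/
def point (k : FinOrd N) (i : Fin k.len) : FinOrd.one hN ⟶ k :=
  OrderHom.const (Fin 1) i

/-- The map `A^1 ⟶ A^n` induced by the map with image `i`. -/
def pt (k : FinOrd N) (i : Fin k.len) : (ev hN).obj X ⟶ X.obj.F.obj k :=
  X.obj.F.map (point hN k i)

theorem pt_map {k l : FinOrd N} (f : k ⟶ l) (i : Fin k.len) :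
    pt hN X k i ≫ X.obj.F.map f = pt hN X l ((show Fin k.len →o Fin l.len from f) i) :=
  (X.obj.F.map_comp _ _).symm

theorem pt_act (k : FinOrd N) (π : Equiv.Perm (Fin k.len)) (i : Fin k.len) :
    pt hN X k i ≫ (X.obj.act k π).hom = pt hN X k (π i) := by
  refine (X.obj.compat (FinOrd.one hN) k (OrderHom.const (Fin 1) i) (OrderHom.const (Fin 1) (π i))
    π 1 (fun _ => rfl) (fun _ _ _ h => h)).trans ?_
  rw [map_one]
  exact Category.id_comp _

theorem pt_one (i : Fin 1) : pt hN X (FinOrd.one hN) i = 𝟙 _ := by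
  refine Eq.trans (congrArg X.obj.F.map ?_) (X.obj.F.map_id _)
  exact OrderHom.ext _ _ (funext fun _ => Subsingleton.elim (α := Fin 1) _ _)

/-- The points of `[n]`, in any order, form a covering family. Orders other than the increasing one
are needed to cancel reversed products. -/
theorem isIso_homProd_pt_comp (k : FinOrd N) (π : Equiv.Perm (Fin k.len)) :
    IsIso (homProd fun i => pt hN X k (π i)) :=
  X.property k.len (fun _ => FinOrd.one hN) k (fun i => point hN k (π i))
    { injective := fun _ _ _ _ => Subsingleton.elim (α := Fin 1) _ _
      disjoint := fun _ _ h => Set.disjoint_left.2 fun _ ⟨_, h1⟩ ⟨_, h2⟩ =>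
        h (π.injective (h1.trans h2.symm))
      cover := Set.eq_univ_of_forall fun x =>
        Set.mem_iUnion.2 ⟨π.symm x, (0 : Fin 1), π.apply_symm_apply x⟩ }

/-- The homomorphism `A^1 ⟶ A^2` onto the first factor. -/
abbrev pt₀ : (ev hN).obj X ⟶ X.obj.F.obj (FinOrd.two hN) := pt hN X (FinOrd.two hN) (0 : Fin 2)

/-- The homomorphism `A^1 ⟶ A^2` onto the second factor. -/
abbrev pt₁ : (ev hN).obj X ⟶ X.obj.F.obj (FinOrd.two hN) := pt hN X (FinOrd.two hN) (1 : Fin 2)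

theorem d_zero : FinOrd.d hN 0 = point hN (FinOrd.two hN) (1 : Fin 2) :=
  OrderHom.ext _ _ (funext fun x => by
    have : x = (0 : Fin 1) := Subsingleton.elim (α := Fin 1) _ _
    subst this; rfl)

theorem d_one : FinOrd.d hN 1 = point hN (FinOrd.two hN) (0 : Fin 2) :=
  OrderHom.ext _ _ (funext fun x => by
    have : x = (0 : Fin 1) := Subsingleton.elim (α := Fin 1) _ _
    subst this; rfl)

theorem dd_zero_one : dd hN X 0 1 = (pt₁ hN X).hom ⋆ (pt₀ hN X).hom := by
  rw [dd, d_zero, d_one]; rfl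

theorem dd_one_zero : dd hN X 1 0 = (pt₀ hN X).hom ⋆ (pt₁ hN X).hom := by
  rw [dd, d_zero, d_one]; rfl

theorem isIso_conv_of_homProd {A B : Mon C} (f : Fin 2 → (A ⟶ B)) (h : IsIso (homProd f)) :
    IsIso ((f 0).hom ⋆ (f 1).hom) := by
  have e : homProd f = (A.X ◁ (ρ_ A.X).hom) ≫ (f 0).hom ⋆ (f 1).hom := by
    rw [homProd, famProd_succ, famProd_succ, famProd_zero, whiskerLeft_conv]
    exact congrArg (conv (f 0).hom) (conv_one _)
  have : IsIso ((A.X ◁ (ρ_ A.X).hom) ≫ (f 0).hom ⋆ (f 1).hom) := by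
    rw [e] at h
    exact h
  exact IsIso.of_isIso_comp_left (A.X ◁ (ρ_ A.X).hom) _

theorem isIso_conv₃_of_homProd {A B : Mon C} (f : Fin 3 → (A ⟶ B)) (h : IsIso (homProd f)) :
    IsIso ((f 0).hom ⋆ (f 1).hom ⋆ (f 2).hom) := by
  have e : homProd f = (A.X ◁ A.X ◁ (ρ_ A.X).hom) ≫ (f 0).hom ⋆ (f 1).hom ⋆ (f 2).hom := by
    rw [homProd, famProd_succ, famProd_succ, famProd_succ, famProd_zero, whiskerLeft_conv,
      whiskerLeft_conv]
    exact congrArg (fun t => conv (f 0).hom (conv (f 1).hom t)) (conv_one _)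
  have : IsIso ((A.X ◁ A.X ◁ (ρ_ A.X).hom) ≫ (f 0).hom ⋆ (f 1).hom ⋆ (f 2).hom) := by
    rw [e] at h
    exact h
  exact IsIso.of_isIso_comp_left (A.X ◁ A.X ◁ (ρ_ A.X).hom) _

instance isIso_dd_one_zero : IsIso (dd hN X 1 0) := by
  rw [dd_one_zero]
  exact isIso_conv_of_homProd _ (isIso_homProd_pt_comp hN X (FinOrd.two hN) 1)

theorem isIso_pt₁_conv_pt₀ : IsIso ((pt₁ hN X).hom ⋆ (pt₀ hN X).hom) :=
  isIso_conv_of_homProd _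
    (isIso_homProd_pt_comp hN X (FinOrd.two hN) (Equiv.swap (0 : Fin 2) (1 : Fin 2)))

instance isIso_dd_zero_one : IsIso (dd hN X 0 1) := by
  rw [dd_zero_one]
  exact isIso_pt₁_conv_pt₀ hN X

/-- The Yang-Baxter operator of a complex. -/
noncomputable def braidIso :
    ((ev hN).obj X).X ⊗ ((ev hN).obj X).X ≅ ((ev hN).obj X).X ⊗ ((ev hN).obj X).X :=
  asIso (dd hN X 1 0) ≪≫ (asIso (dd hN X 0 1)).symm

theorem braidIso_hom_dd : (braidIso hN X).hom ≫ dd hN X 0 1 = dd hN X 1 0 := by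
  simp [braidIso]

/-- The relation defining `R` in `A^2` is transported along the monotone map `[2] → [n]` with values
`i`, `i'`. The case `i = i'` is included, and yields `μR = μ`. -/
theorem pt_conv_pt {k : FinOrd N} {i i' : Fin k.len} (h : i ≤ i') :
    (pt hN X k i).hom ⋆ (pt hN X k i').hom =
      (braidIso hN X).hom ≫ (pt hN X k i').hom ⋆ (pt hN X k i).hom := by
  let g : FinOrd.two hN ⟶ k := (show Fin 2 →o Fin k.len from
    ⟨![i, i'], by
      intro a b hab
      fin_cases a <;> fin_cases b <;> simp_all⟩)
  have h0 : pt₀ hN X ≫ X.obj.F.map g = pt hN X k i := pt_map hN X g (0 : Fin 2)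
  have h1 : pt₁ hN X ≫ X.obj.F.map g = pt hN X k i' := pt_map hN X g (1 : Fin 2)
  rw [← h0, ← h1, Mon.comp_hom', Mon.comp_hom', ← conv_comp, ← conv_comp, ← dd_one_zero,
    ← dd_zero_one, reassoc_of% braidIso_hom_dd hN X]

/-- The quasi-commutative monoid of a complex. -/
noncomputable def toQuasi : QuasiCommMon C where
  toMon := (ev hN).obj X
  R := braidIso hN X
  yang_baxter := by
    -- The covering condition for the points of `[3]` in decreasing order provides the cancellation.
    have : IsIso ((pt hN X ⟨3, hN⟩ (2 : Fin 3)).hom ⋆ (pt hN X ⟨3, hN⟩ (1 : Fin 3)).hom ⋆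
        (pt hN X ⟨3, hN⟩ (0 : Fin 3)).hom) :=
      isIso_conv₃_of_homProd _ (isIso_homProd_pt_comp hN X ⟨3, hN⟩ (Fin.revPerm (n := 3)))
    exact yang_baxter_of_comm
      (pt_conv_pt hN X (k := ⟨3, hN⟩) (show (0 : Fin 3) ≤ 1 by decide))
      (pt_conv_pt hN X (k := ⟨3, hN⟩) (show (1 : Fin 3) ≤ 2 by decide))
      (pt_conv_pt hN X (k := ⟨3, hN⟩) (show (0 : Fin 3) ≤ 2 by decide))
  one_left := by
    have := isIso_pt₁_conv_pt₀ hN X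
    exact one_left_of_comm _ (pt_conv_pt hN X (k := FinOrd.two hN) (show (0 : Fin 2) ≤ 1 by decide))
  one_right := by
    have := isIso_pt₁_conv_pt₀ hN X
    exact one_right_of_comm _ (pt_conv_pt hN X (k := FinOrd.two hN) (show (0 : Fin 2) ≤ 1 by decide))
  mul_right := by
    have := isIso_pt₁_conv_pt₀ hN X
    exact mul_right_of_comm _ (pt_conv_pt hN X (k := FinOrd.two hN) (show (0 : Fin 2) ≤ 1 by decide))
  mul_left := by
    have := isIso_pt₁_conv_pt₀ hN X
    exact mul_left_of_comm _ (pt_conv_pt hN X (k := FinOrd.two hN) (show (0 : Fin 2) ≤ 1 by decide))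
  quasi_comm := by
    have h : 𝟙 ((ev hN).obj X).X ⋆ 𝟙 ((ev hN).obj X).X = (braidIso hN X).hom ≫ 𝟙 _ ⋆ 𝟙 _ := by
      have h := pt_conv_pt hN X (k := FinOrd.one hN) (le_refl (0 : Fin 1))
      rw [pt_one] at h
      exact h
    rw [← mul_comp_eq_conv, Category.comp_id] at h
    exact h.symm

/-- The transposition in `S_2` exchanges the two points of `[2]`, hence the two products `dd` that
define `R`; so `R` equals its inverse. -/
theorem toQuasi_isNearlyComm : QuasiCommMon.isNearlyComm (toQuasi hN X) := by
  let π : Equiv.Perm (Fin 2) := Equiv.swap 0 1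
  have h0 : (pt₀ hN X).hom ≫ (X.obj.act (FinOrd.two hN) π).hom.hom = (pt₁ hN X).hom :=
    congrArg Mon.Hom.hom (pt_act hN X (FinOrd.two hN) π (0 : Fin 2))
  have h1 : (pt₁ hN X).hom ≫ (X.obj.act (FinOrd.two hN) π).hom.hom = (pt₀ hN X).hom :=
    congrArg Mon.Hom.hom (pt_act hN X (FinOrd.two hN) π (1 : Fin 2))
  have h : dd hN X 0 1 ≫ (X.obj.act (FinOrd.two hN) π).hom.hom = dd hN X 1 0 := by
    rw [dd_zero_one, conv_comp, dd_one_zero, h0, h1]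
  have h' : dd hN X 1 0 ≫ (X.obj.act (FinOrd.two hN) π).hom.hom = dd hN X 0 1 := by
    rw [dd_one_zero, conv_comp, dd_zero_one, h0, h1]
  change (braidIso hN X).hom ≫ (braidIso hN X).hom = 𝟙 _
  rw [← cancel_mono (dd hN X 0 1), Category.assoc, braidIso_hom_dd, ← h,
    reassoc_of% braidIso_hom_dd hN X, h', Category.id_comp]

theorem isCover_pt (k : FinOrd N) : IsCover (toQuasi hN X) (pt hN X k) where
  comm i i' := by
    rcases le_total i i' with h | h
    · exact pt_conv_pt hN X h
    · exact RComm.symm (toQuasi_isNearlyComm hN X) (pt_conv_pt hN X h)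
  isIso := isIso_homProd_pt_comp hN X k 1

variable {X} {Y : SymCoveringMon C N}

theorem pt_naturality (φ : X ⟶ Y) (k : FinOrd N) (i : Fin k.len) :
    pt hN X k i ≫ φ.hom.nat.app k = (ev hN).map φ ≫ pt hN Y k i :=
  φ.hom.nat.naturality _

theorem dd_naturality (φ : X ⟶ Y) (i j : Fin 2) :
    dd hN X i j ≫ (φ.hom.nat.app (FinOrd.two hN)).hom =
      (((ev hN).map φ).hom ⊗ₘ ((ev hN).map φ).hom) ≫ dd hN Y i j := by
  have h (i : Fin 2) : (X.obj.F.map (FinOrd.d hN i)).hom ≫ (φ.hom.nat.app (FinOrd.two hN)).hom =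
    ((ev hN).map φ).hom ≫ (Y.obj.F.map (FinOrd.d hN i)).hom :=
    congrArg Mon.Hom.hom (φ.hom.nat.naturality (FinOrd.d hN i))
  exact (conv_comp _ _ _).trans
    ((congrArg₂ conv (h i) (h j)).trans (tensorHom_conv _ _ _ _).symm)

/-- The functor from complexes to nearly commutative monoids. -/
noncomputable def toNearly : SymCoveringMon C N ⥤ NearlyCommMon C where
  obj X := ⟨toQuasi hN X, toQuasi_isNearlyComm hN X⟩
  map {X Y} φ := ObjectProperty.homMk (X := ⟨toQuasi hN X, toQuasi_isNearlyComm hN X⟩)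
    (Y := ⟨toQuasi hN Y, toQuasi_isNearlyComm hN Y⟩) ⟨(ev hN).map φ, by
    change (braidIso hN X).hom ≫ (((ev hN).map φ).hom ⊗ₘ ((ev hN).map φ).hom) =
      (((ev hN).map φ).hom ⊗ₘ ((ev hN).map φ).hom) ≫ (braidIso hN Y).hom
    rw [← cancel_mono (dd hN Y 0 1), Category.assoc, Category.assoc, braidIso_hom_dd,
      ← dd_naturality, ← dd_naturality, reassoc_of% braidIso_hom_dd hN X]⟩

end SymCoveringMon

end Forward

/-! ### Full faithfulness, essential surjectivity, and the compatibility statements. -/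

section Equivalence

variable {C : Type u} [Category.{v} C] [MonoidalCategory C]

theorem QuasiCommMon.eq_of_toMon_eq {M M' : QuasiCommMon C} (h : M.toMon = M'.toMon)
    (h' : HEq M.R M'.R) : M = M' := by
  cases M
  cases M'
  dsimp only at h
  subst h
  obtain rfl := eq_of_heq h'
  rfl

theorem NearlyCommMon.hom_ext {M M' : NearlyCommMon C} {f g : M ⟶ M'}
    (h : f.hom.hom.hom = g.hom.hom.hom) : f = g :=
  ObjectProperty.hom_ext _ (QuasiCommMon.Hom.ext (Mon.Hom.ext h))

namespace SymCoveringMon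

variable {N : ℕ∞} (hN : 3 ≤ N)

theorem hom_ext_of_ev {X Y : SymCoveringMon C N} {φ ψ : X ⟶ Y}
    (h : (ev hN).map φ = (ev hN).map ψ) : φ = ψ := by
  refine ObjectProperty.hom_ext _ (SymCosimplicialMon.Hom.ext (NatTrans.ext (funext fun k => ?_)))
  refine (isCover_pt hN X k).hom_ext fun i => ?_
  exact (pt_naturality hN φ k i).trans 
    ((congrArg (· ≫ pt hN Y k i) h).trans (pt_naturality hN ψ k i).symm)

instance : (toNearly (C := C) hN).Faithful where
  map_injective h := hom_ext_of_ev hN (congrArg (NearlyCommMon.forget C).map h)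

section Lift

variable {X Y : SymCoveringMon C N} (u : toQuasi hN X ⟶ toQuasi hN Y)

/-- The component of the morphism of complexes extending a homomorphism `A^1 ⟶ B^1`. -/
noncomputable def liftApp (k : FinOrd N) : X.obj.F.obj k ⟶ Y.obj.F.obj k :=
  (isCover_pt hN X k).desc (fun i => u.hom ≫ pt hN Y k i)
    fun i i' => RComm.precomp u ((isCover_pt hN Y k).comm i i')

theorem pt_liftApp (k : FinOrd N) (i : Fin k.len) :
    pt hN X k i ≫ liftApp hN u k = u.hom ≫ pt hN Y k i :=
  (isCover_pt hN X k).fac _ _ i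

/-- The morphism of complexes extending a homomorphism `A^1 ⟶ B^1`. -/
noncomputable def lift : X ⟶ Y :=
  ObjectProperty.homMk
    { nat :=
        { app := liftApp hN u
          naturality := fun k l f => (isCover_pt hN X k).hom_ext fun i => by
            refine ((reassoc_of% pt_map hN X f i) _).trans ?_
            rw [pt_liftApp]
            refine Eq.trans ?_ ((reassoc_of% pt_liftApp hN u k i) _).symm
            exact (congrArg (u.hom ≫ ·) (pt_map hN Y f i).symm).trans (Category.assoc _ _ _).symm }
      comm := fun k π => (isCover_pt hN X k).hom_ext fun i => by
        refine Eq.trans ?_ ((reassoc_of% pt_liftApp hN u k i) _).symm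
        refine (Category.assoc _ _ _).symm.trans ?_
        refine (congrArg (· ≫ liftApp hN u k) (pt_act hN X k π i)).trans ?_
        refine (pt_liftApp hN u k (π i)).trans ?_
        exact (congrArg (u.hom ≫ ·) (pt_act hN Y k π i).symm).trans (Category.assoc _ _ _).symm }

theorem ev_map_lift : (ev hN).map (lift hN u) = u.hom := by
  have h := pt_liftApp hN u (FinOrd.one hN) (0 : Fin 1)
  rw [pt_one, pt_one] at h
  exact (Category.id_comp _).symm.trans (h.trans (Category.comp_id _))

end Lift

instance : (toNearly (C := C) hN).Full where
  map_surjective g := ⟨lift hN g.hom,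
    NearlyCommMon.hom_ext (congrArg Mon.Hom.hom (ev_map_lift hN g.hom))⟩

theorem pt_coveringCplx {M : QuasiCommMon C} (hR : QuasiCommMon.isNearlyComm M) (k : FinOrd N)
    (i : Fin k.len) : pt hN (coveringCplx hR N) k i = cplxIncl M k.len i :=
  (Category.id_comp _).symm.trans (cplxIncl_map hR (fun _ : Fin 1 => i) 0)

/-- The operator of the complex is determined by its defining equation in `A^2`, and the original
`R` satisfies it because the two inclusions commute up to `R`. The result is an equality, as
`exists_complex` demands. -/
theorem toQuasi_coveringCplx {M : QuasiCommMon C} (hR : QuasiCommMon.isNearlyComm M) :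
    toQuasi hN (coveringCplx hR N) = M := by
  refine QuasiCommMon.eq_of_toMon_eq rfl (heq_of_eq ?_)
  refine Iso.ext ?_
  have h (a b : M.toMon ⟶ cplxMon M 2) (ha : a = cplxIncl M 2 0) (hb : b = cplxIncl M 2 1) :
      RComm M a b := by
    rw [ha, hb]
    exact (isCover_cplxIncl hR 2).comm 0 1
  refine (cancel_mono (dd hN (coveringCplx hR N) 0 1)).1 ((braidIso_hom_dd hN _).trans ?_)
  rw [dd_zero_one, dd_one_zero]
  exact h _ _ (pt_coveringCplx hN hR (FinOrd.two hN) (0 : Fin 2))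
    (pt_coveringCplx hN hR (FinOrd.two hN) (1 : Fin 2))

theorem toNearly_coveringCplx (M : NearlyCommMon C) :
    (toNearly hN).obj (coveringCplx M.property N) = M :=
  ObjectProperty.FullSubcategory.ext (toQuasi_coveringCplx hN M.property)

instance : (toNearly (C := C) hN).EssSurj where
  mem_essImage M := ⟨_, ⟨eqToIso (toNearly_coveringCplx hN M)⟩⟩

instance : (toNearly (C := C) hN).IsEquivalence where

theorem isCompatible_toNearly :
    IsCompatible hN (toNearly (C := C) hN).asEquivalence where
  forget_eq := rfl
  yang_baxter X := by
    intro e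
    have he : e = 𝟙 _ := rfl
    rw [he]
    change (braidIso hN X).hom ≫ (𝟙 _ ⊗ₘ 𝟙 _) ≫ _ = (𝟙 _ ⊗ₘ 𝟙 _) ≫ _
    rw [id_tensorHom_id, Category.id_comp, Category.id_comp, braidIso_hom_dd]
  exists_complex A S := ⟨⟨coveringCplx S.1.property N, S.2⟩, toNearly_coveringCplx hN S.1⟩
  unique_complex A S X Y hX hY := by
    have e : (toNearly hN).obj X.1 = (toNearly hN).obj Y.1 := hX.trans hY.symm
    have he : (eqToHom e).hom.hom.hom = eqToHom (X.2.trans Y.2.symm) :=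
      eqToHom_map (NearlyCommMon.forget C ⋙ Mon.forget C) e
    -- Fullness lifts the identification of the two structures to an isomorphism of complexes, and
    -- faithfulness makes it unique.
    refine ⟨(toNearly hN).preimageIso (eqToIso e), ?_, fun ψ hψ => ?_⟩
    · refine Eq.trans ?_ he
      change ((toNearly hN).map ((toNearly hN).preimage (eqToHom e))).hom.hom.hom = _
      rw [Functor.map_preimage]
    · refine Iso.ext ((toNearly hN).map_injective (NearlyCommMon.hom_ext ?_))
      rw [Functor.preimageIso_hom, Functor.map_preimage, eqToIso.hom, he]
      exact hψ

end SymCoveringMon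

end Equivalence

end NearlyComm

theorem mainTheorem3 (C : Type u) [Category.{v} C] [MonoidalCategory C] :
    ∃ (E : NearlyComm.SymCoveringMon C ⊤ ≌ NearlyComm.NearlyCommMon C)
      (E₃ : NearlyComm.SymCoveringMon C 3 ≌ NearlyComm.NearlyCommMon C),
      NearlyComm.IsCompatible (N := ⊤) le_top E ∧
      NearlyComm.IsCompatible (N := 3) le_rfl E₃ ∧
      E.functor = NearlyComm.SymCoveringMon.trunc (N := 3) (N' := ⊤) le_top ⋙ E₃.functor :=
  ⟨_, _, NearlyComm.SymCoveringMon.isCompatible_toNearly le_top,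
    -- The data of `toNearly` involve only degrees 1 and 2, which truncation leaves unchanged;
    -- degree 3 enters only in proofs.
    NearlyComm.SymCoveringMon.isCompatible_toNearly le_rfl, rfl⟩
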